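/- Fix integers $m,n,d\ge 0$ and a linear latent non-Gaussian model: a design matrix $X\in\mathbb R^{m\times d}$, coefficients $\beta\in\mathbb R^d$, an observation matrix $A\in\mathbb R^{m\times n}$, an invertible matrix $K\in\mathbb R^{n\times n}$, a vector $h\in\mathbb R^n$, and real parameters $\mu$, $\sigma>0$, $\sigma_\epsilon>0$, $p,a,b$. In the centered parameterization the latent variable is $U=W$, with $$Y\mid W,V\sim N(X\beta+AW,\ \sigma_\epsilon^2 I),\qquad KW\mid V\sim N(\mu V-\mu h,\ \mathrm{diag}(\sigma^2V)),\qquad V_i\overset{\mathrm{ind.}}{\sim}\mathrm{GIG}(p,a,b),\quad i=1,\dots,n;$$ in the non-centered parameterization it is $U=M$, with $$Y\mid M,V\sim N(X\beta+AK^{-1}(M-\mu h),\ \sigma_\epsilon^2 I),\qquad M\mid V\sim N(\mu V,\ \mathrm{diag}(\sigma^2V)),\qquad V_i\overset{\mathrm{ind.}}{\sim}\mathrm{GIG}(p,a,b),\quad i=1,\dots,n.$$ Here $\mathrm{GIG}(p,a,b)$ is the law on $(0,\infty)$ with density proportional to $x^{p-1}\exp\{-\tfrac12(ax+b/x)\}$.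 Fix data $Y\in\mathbb R^m$ and either parameterization, and write $\pi(U\mid V,Y)$, $\pi(V\mid U,Y)$, $\pi(V\mid Y)$ for the conditional densities obtained from the joint density of $(Y,U,V)$, where $V\in\mathbb R^n_+=(0,\infty)^n$. The Gibbs sampler, which alternately draws $U$ from $\pi(U\mid V,Y)$ and $V$ from $\pi(V\mid U,Y)$, gives on $V$ the transition density $$k(V,\tilde V)=\int_{\mathbb R^n}\pi(\tilde V\mid U,Y)\,\pi(U\mid V,Y)\,dU .$$ Let $\pi(dV)=\pi(V\mid Y)\,dV$ on $\mathbb R^n_+$. **Theorem 2.6.** Suppose that one of the following holds: 1. $a>0$, $b>0$ (and $p\in\mathbb R$ is arbitrary); 2. $a>0$, $b=0$ and $p>\tfrac12$. Then $\pi$ is a probability measure, $k(V,\cdot)$ is a probability density on $\mathbb R^n_+$ for every $V\in\mathbb R^n_+$, and the Markov operator $$(\Lambda f)(V)=\int_{\mathbb R^n_+}k(V,\tilde V)\,f(\tilde V)\,d\tilde V$$ is a well-defined bounded operator on the real Hilbert space $L_2(\pi)$ (for each $f\in L_2(\pi)$ the integral converges absolutely for $\pi$-almost every $V$) and is trace-class,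 i.e. its singular values are summable: there are orthonormal families $(e_i)$, $(f_i)$ in $L_2(\pi)$ and numbers $s_i\ge 0$ with $\sum_i s_i<\infty$ and $\Lambda g=\sum_i s_i\langle e_i,g\rangle f_i$ for all $g\in L_2(\pi)$. -/

import Mathlib

open MeasureTheory ProbabilityTheory

noncomputable section

/-- A bounded operator `T` on a real Hilbert space is trace-class if its singular values are
summable: it has a singular value decomposition `T x = ∑ i, s i * ⟪e i, x⟫ • f i`, with `e` and `f`
orthonormal and singular values `s i ≥ 0` such that `∑ i, s i < ∞`. -/
def IsTraceClass {H : Type*} [NormedAddCommGroup H] [InnerProductSpace ℝ H]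
    (T : H →L[ℝ] H) : Prop :=
  ∃ (ι : Type) (s : ι → ℝ) (e f : ι → H),
    Orthonormal ℝ e ∧ Orthonormal ℝ f ∧ (∀ i, 0 ≤ s i) ∧ Summable s ∧
      ∀ x : H, HasSum (fun i => (s i * inner ℝ (e i) x) • f i) (T x)

/-- The density at `x > 0` of the generalized inverse Gaussian law `GIG(p, a, b)`, that is
`x ^ (p - 1) * exp (-(a * x + b / x) / 2)` normalized to integrate to one over `(0, ∞)`.
For `a, b > 0` the normalizing integral is `2 K_p(√(ab)) (b / a) ^ (p / 2)`, with `K_p` the modified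
Bessel function of the second kind; for `a > 0`, `b = 0`, `p > 0` this is a gamma density. -/
def gigPDF (p a b x : ℝ) : ℝ :=
  x ^ (p - 1) * Real.exp (-(a * x + b / x) / 2) /
    ∫ t in Set.Ioi (0 : ℝ), t ^ (p - 1) * Real.exp (-(a * t + b / t) / 2)

/-- The open positive orthant `ℝ^n_+`. -/
def orthant (n : ℕ) : Set (Fin n → ℝ) := {V | ∀ i, 0 < V i}

/-- The parameters of a linear latent non-Gaussian model with `m` observations, `n` latent
variables and `d` regression coefficients. -/
structure LLnGM (m n d : ℕ) where
  /-- design matrix -/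
  X : Matrix (Fin m) (Fin d) ℝ
  /-- regression coefficients -/
  β : Fin d → ℝ
  /-- observation matrix -/
  A : Matrix (Fin m) (Fin n) ℝ
  /-- operator matrix -/
  K : Matrix (Fin n) (Fin n) ℝ
  h : Fin n → ℝ
  /-- skewness (drift) parameter -/
  μ : ℝ
  /-- scale of the latent noise -/
  σ : ℝ
  /-- standard deviation of the measurement noise -/
  σε : ℝ
  /-- parameters of the GIG mixing law -/
  p : ℝ
  a : ℝ
  b : ℝ
  K_invertible : IsUnit K
  σ_pos : 0 < σ
  σε_pos : 0 < σε

/-- The latent variable that the Gibbs sampler updates: the field `W` (centered), or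
`M = K W + μ h` (non-centered). -/
inductive Parameterization
  | centered
  | nonCentered

namespace LLnGM

variable {m n d : ℕ}

/-- Density at `y` of `Y ∣ W ∼ N(X β + A W, σε² I)`. -/
def dataPDF (L : LLnGM m n d) (y : Fin m → ℝ) (W : Fin n → ℝ) : ℝ :=
  ∏ j, gaussianPDFReal ((L.X.mulVec L.β + L.A.mulVec W) j) (L.σε ^ 2).toNNReal (y j)

/-- Density at `V` (in the positive orthant) of the mixing variables `V_i ∼ GIG(p, a, b)`,
independent. -/
def mixPDF (L : LLnGM m n d) (V : Fin n → ℝ) : ℝ :=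
  ∏ i, gigPDF L.p L.a L.b (V i)

/-- Density at `W` of `W ∣ V`, where `K W ∣ V ∼ N(μ V - μ h, diag(σ² V))`. -/
def fieldPDFCentered (L : LLnGM m n d) (V W : Fin n → ℝ) : ℝ :=
  |L.K.det| * ∏ i, gaussianPDFReal (L.μ * V i - L.μ * L.h i) (L.σ ^ 2 * V i).toNNReal
    (L.K.mulVec W i)

/-- Density at `M` of `M ∣ V ∼ N(μ V, diag(σ² V))`. -/
def fieldPDFNonCentered (L : LLnGM m n d) (V M : Fin n → ℝ) : ℝ :=
  ∏ i, gaussianPDFReal (L.μ * V i) (L.σ ^ 2 * V i).toNNReal (M i)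

/-- The joint density of `(Y, U, V)` at `(y, U, V)`, where `U` is the latent variable of the
chosen parameterization. -/
def jointPDF (L : LLnGM m n d) (y : Fin m → ℝ) : Parameterization →
    (Fin n → ℝ) → (Fin n → ℝ) → ℝ
  | .centered => fun W V => L.dataPDF y W * L.fieldPDFCentered V W * L.mixPDF V
  | .nonCentered => fun M V =>
      L.dataPDF y (L.K⁻¹.mulVec (M - L.μ • L.h)) * L.fieldPDFNonCentered V M * L.mixPDF V

/-- The conditional density `π(U ∣ V, Y)`, first Gibbs step. -/
def latentCondPDF (L : LLnGM m n d) (y : Fin m → ℝ) (c : Parameterization)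
    (V U : Fin n → ℝ) : ℝ :=
  L.jointPDF y c U V / ∫ U', L.jointPDF y c U' V

/-- The conditional density `π(V ∣ U, Y)`, second Gibbs step. -/
def mixCondPDF (L : LLnGM m n d) (y : Fin m → ℝ) (c : Parameterization)
    (U V : Fin n → ℝ) : ℝ :=
  L.jointPDF y c U V / ∫ V' in orthant n, L.jointPDF y c U V'

/-- The density `π(V ∣ Y)` of the target of the `V`-marginal chain. -/
def posteriorPDF (L : LLnGM m n d) (y : Fin m → ℝ) (c : Parameterization)
    (V : Fin n → ℝ) : ℝ :=
  (∫ U, L.jointPDF y c U V) / ∫ V' in orthant n, ∫ U, L.jointPDF y c U V'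

/-- The posterior law `π(dV) = π(V ∣ Y) dV` on the positive orthant. -/
def posterior (L : LLnGM m n d) (y : Fin m → ℝ) (c : Parameterization) :
    Measure (Fin n → ℝ) :=
  (volume.restrict (orthant n)).withDensity fun V => ENNReal.ofReal (L.posteriorPDF y c V)

/-- The transition density of the `V`-marginal Gibbs chain:
`k(V, V') = ∫ π(V' ∣ U, Y) π(U ∣ V, Y) dU`. -/
def transitionPDF (L : LLnGM m n d) (y : Fin m → ℝ) (c : Parameterization)
    (V V' : Fin n → ℝ) : ℝ :=
  ∫ U, L.mixCondPDF y c U V' * L.latentCondPDF y c V U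

/-- `Λ` is the Markov operator on `L₂(π)` of the `V`-marginal chain:
`(Λ g)(V) = ∫ k(V, V') g(V') dV'` for `π`-almost every `V`, with convergent integrals. -/
def IsMarkovOperator (L : LLnGM m n d) (y : Fin m → ℝ) (c : Parameterization)
    (Λ : Lp ℝ 2 (L.posterior y c) →L[ℝ] Lp ℝ 2 (L.posterior y c)) : Prop :=
  ∀ g : Lp ℝ 2 (L.posterior y c), ∀ᵐ V ∂(L.posterior y c),
    IntegrableOn (fun V' => L.transitionPDF y c V V' * g V') (orthant n) ∧
      Λ g V = ∫ V' in orthant n, L.transitionPDF y c V V' * g V'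

end LLnGM

end

/-! Write `J(U,V)` for the joint density at the fixed data, `J_U` and `J_V` for its marginals and
`Z` for its total mass. The Gibbs chain on `V` is a data augmentation chain, so `Λ = S† S`, where `S
: L₂(π) → L₂(dU)` has kernel `J √Z / (J_V √J_U)`. Such a product is trace-class as soon as `S` is
Hilbert–Schmidt, that is, as soon as `∬ J² / (J_U J_V) < ∞`
(`isTraceClassChain_of_lintegral_lt_top`). The substitution `M = K W + μ h` turns the centered chain
into the non-centered one, so only the latter is studied.

There `J(M,V) = ℓ(M) ∏ f(M_i,V_i)` with a Gaussian likelihood `ℓ`. The marginal `J_U` factorizes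
over coordinates but `J_V` does not. Since `J` is Gaussian in `M`, comparing it at `N + ξ` and `N -
ξ` bounds `J_V(V)` below by `J(N,V)` times a product of one-dimensional Gaussian integrals, for
every `N` (`latentJoint_mul_le_integral`). With `N = t M`, `0 ≤ t ≤ 1`, the likelihood cancels
because `ℓ(M) ≤ k ℓ(tM)`, and the integrand is dominated by a product of functions of `(M_i,V_i)`.

The remaining one-dimensional estimate is `exists_coordPDF_sq_le`. The marginal of `M_i` decays
essentially like `exp(-√α |z| + (μ/σ) z)`, with `z = M_i/σ` and `α = a + (μ/σ)²`. For `t = 1` the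
exponents balance exactly along `v = |z|/√α` and nothing is left to integrate. A `t` slightly below
`1` gains a margin, because `|μ/σ| < √α`; this is where `a > 0` matters. The condition `p > 1/2`
when `b = 0` gives integrability of `v^(p - 3/2)` at the origin. -/

/-! ### Hilbert–Schmidt and trace-class operators -/

open Filter Topology in
theorem isCompactOperator_of_hilbertSchmidt {H G : Type*}
    [NormedAddCommGroup H] [InnerProductSpace ℝ H]
    [NormedAddCommGroup G] [InnerProductSpace ℝ G] [CompleteSpace G]
    {ι : Type*} (b : HilbertBasis ι ℝ H) (S : H →L[ℝ] G)
    (hS : Summable fun i => ‖S (b i)‖ ^ 2) : IsCompactOperator S := by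
  classical
  let T : Finset ι → H →L[ℝ] G := fun F => ∑ i ∈ F, (innerSL ℝ (b i)).smulRight (S (b i))
  have hT : ∀ F x, T F x = ∑ i ∈ F, (inner ℝ (b i) x) • S (b i) := by
    intro F x
    simp [T]
  have hTS : ∀ x, Tendsto (fun F => T F x) atTop (𝓝 (S x)) := by
    intro x
    have h := (b.hasSum_repr x).mapL S
    simp only [map_smul, b.repr_apply_apply] at h
    simpa only [hT] using! h
  have htail := tendsto_tsum_compl_atTop_zero fun i => ‖S (b i)‖ ^ 2
  -- Cauchy–Schwarz on the coefficients outside `F`, with Bessel's inequality for `x`. The bound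
  -- does not depend on `F'`, so it passes to the limit and gives convergence of the finite-rank
  -- truncations in operator norm.
  have hcauchy : ∀ F F' x, F ⊆ F' →
      ‖T F' x - T F x‖ ≤ √(∑' i : {i // i ∉ F}, ‖S (b i)‖ ^ 2) * ‖x‖ := by
    intro F F' x hF
    have h1 : T F' x - T F x = ∑ i ∈ F' \ F, (inner ℝ (b i) x) • S (b i) := by
      rw [hT, hT, ← Finset.sum_sdiff hF, add_sub_cancel_right]
    have h2 : ∑ i ∈ F' \ F, ‖S (b i)‖ ^ 2 ≤ ∑' i : {i // i ∉ F}, ‖S (b i)‖ ^ 2 := by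
      have hs : Summable fun i : {i // i ∉ F} => ‖S (b i)‖ ^ 2 :=
        hS.subtype (fun i => i ∉ F)
      refine le_trans (le_of_eq ?_)
        (hs.sum_le_tsum ((F' \ F).subtype (fun i => i ∉ F)) (fun i _ => sq_nonneg _))
      rw [Finset.sum_subtype_of_mem (f := fun i => ‖S (b i)‖ ^ 2)]
      intro i hi
      exact (Finset.mem_sdiff.1 hi).2
    have h3 : ∑ i ∈ F' \ F, |inner ℝ (b i) x| ^ 2 ≤ ‖x‖ ^ 2 := by
      simpa using b.orthonormal.sum_inner_products_le x (s := F' \ F)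
    calc ‖T F' x - T F x‖ ≤ ∑ i ∈ F' \ F, ‖(inner ℝ (b i) x) • S (b i)‖ := by
          rw [h1]; exact norm_sum_le _ _
      _ = ∑ i ∈ F' \ F, ‖S (b i)‖ * |inner ℝ (b i) x| := by
          refine Finset.sum_congr rfl fun i _ => ?_
          rw [norm_smul, Real.norm_eq_abs, mul_comm]
      _ ≤ √(∑ i ∈ F' \ F, ‖S (b i)‖ ^ 2) * √(∑ i ∈ F' \ F, |inner ℝ (b i) x| ^ 2) :=
          Real.sum_mul_le_sqrt_mul_sqrt _ _ _
      _ ≤ √(∑' i : {i // i ∉ F}, ‖S (b i)‖ ^ 2) * ‖x‖ := by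
          gcongr
          exact (Real.sqrt_le_sqrt h3).trans_eq (Real.sqrt_sq (norm_nonneg _))
  have hbound : ∀ F, ‖T F - S‖ ≤ √(∑' i : {i // i ∉ F}, ‖S (b i)‖ ^ 2) := by
    intro F
    refine ContinuousLinearMap.opNorm_le_bound _ (Real.sqrt_nonneg _) fun x => ?_
    rw [sub_apply, norm_sub_rev]
    refine le_of_tendsto ((hTS x).sub_const (T F x)).norm ?_
    filter_upwards [eventually_ge_atTop F] with F' hF'
    exact hcauchy F F' x hF'
  have hlim : Tendsto T atTop (𝓝 S) := by
    rw [tendsto_iff_norm_sub_tendsto_zero]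
    refine squeeze_zero (fun _ => norm_nonneg _) hbound ?_
    simpa using htail.sqrt
  refine isCompactOperator_of_tendsto hlim (Eventually.of_forall fun F => ?_)
  change T F ∈ compactOperator (RingHom.id ℝ) H G
  refine Submodule.sum_mem _ fun i _ => ?_
  have hi : IsCompactOperator (innerSL ℝ (b i)) :=
    isCompactOperator_of_locallyCompactSpace_dom (innerSL ℝ (b i))
  exact hi.clm_comp (ContinuousLinearMap.toSpanSingleton ℝ (S (b i)))

/-- A compact symmetric operator has a Hilbert basis of eigenvectors. -/
theorem exists_hilbertBasis_eigenvectors {H : Type} [NormedAddCommGroup H] [InnerProductSpace ℝ H]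
    [CompleteSpace H] (T : H →L[ℝ] H) (hT : IsCompactOperator T)
    (hT' : (T : H →ₗ[ℝ] H).IsSymmetric) :
    ∃ (ι : Type) (b : HilbertBasis ι ℝ H) (l : ι → ℝ), ∀ i, T (b i) = l i • b i := by
  classical
  have hc : ∀ μ : ℝ, CompleteSpace (Module.End.eigenspace (T : H →ₗ[ℝ] H) μ) := by
    intro μ
    have : IsClosed (Module.End.eigenspace (T : H →ₗ[ℝ] H) μ : Set H) := by
      have h : (Module.End.eigenspace (T : H →ₗ[ℝ] H) μ : Set H) = {x | T x = μ • x} := by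
        ext x; simp
      rw [h]
      exact isClosed_eq T.continuous (continuous_const_smul μ)
    exact this.completeSpace_coe
  -- Every real `μ` is allowed: a non-eigenvalue has a trivial eigenspace and contributes no vector,
  -- while `μ = 0` contributes a basis of the kernel, needed for a basis of the whole space.
  choose w B hB using fun μ : ℝ =>
    exists_hilbertBasis ℝ (Module.End.eigenspace (T : H →ₗ[ℝ] H) μ)
  let v : (Σ μ : ℝ, w μ) → H := fun i => (B i.1 i.2 : H)
  have hv : Orthonormal ℝ v :=
    hT'.orthogonalFamily_eigenspaces.orthonormal_sigma_orthonormal (fun μ => (B μ).orthonormal)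
  have hsp : (Submodule.span ℝ (Set.range v))ᗮ = ⊥ := by
    rw [eq_bot_iff, ← ContinuousLinearMap.orthogonalComplement_iSup_eigenspaces_eq_bot hT hT']
    intro x hx
    rw [Submodule.mem_orthogonal] at hx ⊢
    have key : ∀ μ, ∀ u ∈ Module.End.eigenspace (T : H →ₗ[ℝ] H) μ, inner ℝ u x = 0 := by
      intro μ u hu
      have h := ((B μ).hasSum_repr ⟨u, hu⟩).mapL
        (Submodule.subtypeL (Module.End.eigenspace (T : H →ₗ[ℝ] H) μ))
      have h2 := h.mapL (innerSL ℝ x)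
      have h3 : ∀ i, innerSL ℝ x ((Submodule.subtypeL
          (Module.End.eigenspace (T : H →ₗ[ℝ] H) μ)) ((B μ).repr ⟨u, hu⟩ i • B μ i)) = 0 := by
        intro i
        have := hx (v ⟨μ, i⟩) (Submodule.subset_span ⟨_, rfl⟩)
        rw [real_inner_comm] at this
        simp only [map_smul, innerSL_apply_apply, Submodule.subtypeL_apply]
        rw [this, smul_zero]
      simp only [h3] at h2
      have := h2.unique hasSum_zero
      rw [real_inner_comm]
      simpa using this
    intro u hu
    induction hu using Submodule.iSup_induction' with
    | mem μ u hu => exact key μ u hu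
    | zero => simp
    | add u u' _ _ h h' => rw [inner_add_left, h, h', add_zero]
  refine ⟨_, HilbertBasis.mkOfOrthogonalEqBot hv hsp, fun i => i.1, fun i => ?_⟩
  rw [HilbertBasis.coe_mkOfOrthogonalEqBot]
  exact Module.End.mem_eigenspace_iff.1 (B i.1 i.2).2

/-- If `S` is Hilbert–Schmidt, then `S† S` is trace-class. -/
theorem isTraceClass_adjoint_comp_self {H : Type} {G : Type*}
    [NormedAddCommGroup H] [InnerProductSpace ℝ H] [CompleteSpace H]
    [NormedAddCommGroup G] [InnerProductSpace ℝ G] [CompleteSpace G] (S : H →L[ℝ] G)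
    (hS : ∀ (ι : Type) (v : ι → H), Orthonormal ℝ v → Summable fun i => ‖S (v i)‖ ^ 2) :
    IsTraceClass ((ContinuousLinearMap.adjoint S).comp S) := by
  obtain ⟨w, b₀, -⟩ := exists_hilbertBasis ℝ H
  have hc : IsCompactOperator S :=
    isCompactOperator_of_hilbertSchmidt b₀ S (hS _ _ b₀.orthonormal)
  have hcc : IsCompactOperator ((ContinuousLinearMap.adjoint S).comp S) :=
    hc.clm_comp (ContinuousLinearMap.adjoint S)
  obtain ⟨ι, b, l, hl⟩ := exists_hilbertBasis_eigenvectors ((ContinuousLinearMap.adjoint S).comp S)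
    hcc (fun x y => by
      simp [ContinuousLinearMap.adjoint_inner_left, ContinuousLinearMap.adjoint_inner_right])
  -- The eigenvalues of `S† S` are its singular values, and this identity makes their sum the
  -- squared Hilbert–Schmidt norm of `S`.
  have hl' : ∀ i, l i = ‖S (b i)‖ ^ 2 := by
    intro i
    have h : inner ℝ (((ContinuousLinearMap.adjoint S).comp S) (b i)) (b i) = l i := by
      rw [hl, real_inner_smul_left, real_inner_self_eq_norm_sq, b.orthonormal.1 i]; simp
    rw [← h, ContinuousLinearMap.comp_apply, ContinuousLinearMap.adjoint_inner_left,
      real_inner_self_eq_norm_sq]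
  refine ⟨ι, l, b, b, b.orthonormal, b.orthonormal, fun i => ?_, ?_, fun x => ?_⟩
  · rw [hl']; positivity
  · rw [funext hl']
    exact hS _ _ b.orthonormal
  · have h := (b.hasSum_repr x).mapL ((ContinuousLinearMap.adjoint S).comp S)
    simp only [map_smul, b.repr_apply_apply, hl, smul_smul] at h
    simpa only [mul_comm] using h

/-! ### Integral operators with square integrable kernels -/

section IntegralOperator

variable {X Y : Type} [MeasurableSpace X] [MeasurableSpace Y] {μ : Measure Y} {ν : Measure X}

theorem real_inner_eq_mul (a b : ℝ) : inner ℝ a b = a * b := by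
  simp [mul_comm]

theorem integral_mul_eq_inner_toLp {u : X → ℝ} (hu : MemLp u 2 ν) (g : Lp ℝ 2 ν) :
    ∫ x, u x * g x ∂ν = inner ℝ (hu.toLp u) g := by
  rw [L2.inner_def]
  refine integral_congr_ae ?_
  filter_upwards [hu.coeFn_toLp] with x hx
  rw [hx, real_inner_eq_mul]

theorem norm_sq_toLp_two {u : X → ℝ} (hu : MemLp u 2 ν) :
    ‖hu.toLp u‖ ^ 2 = ∫ x, u x ^ 2 ∂ν := by
  rw [← real_inner_self_eq_norm_sq, ← integral_mul_eq_inner_toLp]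
  refine integral_congr_ae ?_
  filter_upwards [hu.coeFn_toLp] with x hx
  rw [hx, sq]

theorem memLp_two_tensor (f : Lp ℝ 2 μ) (g : Lp ℝ 2 ν) :
    MemLp (fun p : Y × X => f p.1 * g p.2) 2 (μ.prod ν) := by
  have hm : AEStronglyMeasurable (fun p : Y × X => f p.1 * g p.2) (μ.prod ν) :=
    (Lp.aestronglyMeasurable f).comp_fst.mul (Lp.aestronglyMeasurable g).comp_snd
  rw [memLp_two_iff_integrable_sq hm]
  simp only [mul_pow]
  exact (Lp.memLp f).integrable_sq.mul_prod (Lp.memLp g).integrable_sq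

variable [SFinite ν] {s : Y → X → ℝ}

theorem aestronglyMeasurable_integral_mul (hs : MemLp (Function.uncurry s) 2 (μ.prod ν))
    (g : Lp ℝ 2 ν) : AEStronglyMeasurable (fun y => ∫ x, s y x * g x ∂ν) μ :=
  (hs.1.mul ((Lp.aestronglyMeasurable g).comp_snd (μ := μ))).integral_prod_right'

theorem integrable_integral_sq (hs : MemLp (Function.uncurry s) 2 (μ.prod ν)) :
    Integrable (fun y => ∫ x, s y x ^ 2 ∂ν) μ :=
  hs.integrable_sq.integral_prod_left

variable [SFinite μ]

theorem ae_memLp_two_section (hs : MemLp (Function.uncurry s) 2 (μ.prod ν)) :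
    ∀ᵐ y ∂μ, MemLp (s y) 2 ν := by
  filter_upwards [hs.1.prodMk_left, hs.integrable_sq.prod_right_ae] with y h1 h2
  exact (memLp_two_iff_integrable_sq h1).2 h2

theorem ae_sq_integral_mul_le (hs : MemLp (Function.uncurry s) 2 (μ.prod ν)) (g : Lp ℝ 2 ν) :
    ∀ᵐ y ∂μ, (∫ x, s y x * g x ∂ν) ^ 2 ≤ (∫ x, s y x ^ 2 ∂ν) * ‖g‖ ^ 2 := by
  filter_upwards [ae_memLp_two_section hs] with y hy
  rw [integral_mul_eq_inner_toLp hy, ← norm_sq_toLp_two hy, ← mul_pow]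
  exact sq_le_sq' (by linarith [neg_le_of_abs_le (abs_real_inner_le_norm (hy.toLp (s y)) g)])
    (real_inner_le_norm _ _)

theorem memLp_integral_mul (hs : MemLp (Function.uncurry s) 2 (μ.prod ν)) (g : Lp ℝ 2 ν) :
    MemLp (fun y => ∫ x, s y x * g x ∂ν) 2 μ := by
  have hm := aestronglyMeasurable_integral_mul hs g
  rw [memLp_two_iff_integrable_sq hm]
  refine ((integrable_integral_sq hs).mul_const (‖g‖ ^ 2)).mono' (hm.pow 2) ?_
  filter_upwards [ae_sq_integral_mul_le hs g] with y hy
  rwa [Real.norm_of_nonneg (sq_nonneg _)]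

/-- The Hilbert–Schmidt integral operator with a square integrable kernel. -/
noncomputable def kernelOperator (hs : MemLp (Function.uncurry s) 2 (μ.prod ν)) :
    Lp ℝ 2 ν →L[ℝ] Lp ℝ 2 μ :=
  LinearMap.mkContinuous
    { toFun := fun g => (memLp_integral_mul hs g).toLp _
      map_add' := fun g g' => by
        rw [← MemLp.toLp_add]
        refine MemLp.toLp_congr _ _ ?_
        filter_upwards [ae_memLp_two_section hs] with y hy
        simp only [Pi.add_apply]
        rw [integral_mul_eq_inner_toLp hy, integral_mul_eq_inner_toLp hy,
          integral_mul_eq_inner_toLp hy, inner_add_right]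
      map_smul' := fun r g => by
        rw [RingHom.id_apply, ← MemLp.toLp_const_smul]
        refine MemLp.toLp_congr _ _ ?_
        filter_upwards [ae_memLp_two_section hs] with y hy
        simp only [Pi.smul_apply]
        rw [integral_mul_eq_inner_toLp hy, integral_mul_eq_inner_toLp hy, real_inner_smul_right,
          smul_eq_mul] }
    √(∫ y, ∫ x, s y x ^ 2 ∂ν ∂μ)
    (fun g => by
      refine le_of_sq_le_sq ?_ (by positivity)
      change ‖(memLp_integral_mul hs g).toLp _‖ ^ 2 ≤ _
      rw [norm_sq_toLp_two, mul_pow, Real.sq_sqrt (integral_nonneg fun y => integral_nonneg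
        fun x => sq_nonneg _), ← integral_mul_const]
      exact integral_mono_ae (memLp_integral_mul hs g).integrable_sq
        ((integrable_integral_sq hs).mul_const _) (ae_sq_integral_mul_le hs g))

theorem kernelOperator_ae_eq (hs : MemLp (Function.uncurry s) 2 (μ.prod ν)) (g : Lp ℝ 2 ν) :
    kernelOperator hs g =ᵐ[μ] fun y => ∫ x, s y x * g x ∂ν :=
  (memLp_integral_mul hs g).coeFn_toLp

theorem norm_sq_kernelOperator (hs : MemLp (Function.uncurry s) 2 (μ.prod ν)) (g : Lp ℝ 2 ν) :
    ‖kernelOperator hs g‖ ^ 2 = ∫ y, (∫ x, s y x * g x ∂ν) ^ 2 ∂μ :=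
  norm_sq_toLp_two (memLp_integral_mul hs g)

/-- For almost every `y`, the values at `y` of the images of the `v i` are the inner products of the
section `s y` with the `v i`. Bessel's inequality bounds their sum of squares by `‖s y‖²`, and
integration over `y` bounds all finite partial sums uniformly. -/
theorem summable_norm_sq_kernelOperator (hs : MemLp (Function.uncurry s) 2 (μ.prod ν))
    {ι : Type} {v : ι → Lp ℝ 2 ν} (hv : Orthonormal ℝ v) :
    Summable fun i => ‖kernelOperator hs (v i)‖ ^ 2 := by
  refine summable_of_sum_le (c := ∫ y, ∫ x, s y x ^ 2 ∂ν ∂μ) (fun i => sq_nonneg _) fun F => ?_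
  simp only [norm_sq_kernelOperator]
  rw [← integral_finsetSum _ fun i _ => (memLp_integral_mul hs (v i)).integrable_sq]
  refine integral_mono_ae (integrable_finsetSum _ fun i _ =>
    (memLp_integral_mul hs (v i)).integrable_sq) (integrable_integral_sq hs) ?_
  filter_upwards [ae_memLp_two_section hs] with y hy
  rw [← norm_sq_toLp_two hy]
  simp only [integral_mul_eq_inner_toLp hy]
  have := hv.sum_inner_products_le (hy.toLp (s y)) (s := F)
  simpa [real_inner_comm] using this

theorem memLp_two_swap_kernel (hs : MemLp (Function.uncurry s) 2 (μ.prod ν)) :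
    MemLp (Function.uncurry fun x y => s y x) 2 (ν.prod μ) :=
  hs.comp_measurePreserving (Measure.measurePreserving_swap (μ := ν) (ν := μ))

theorem adjoint_kernelOperator (hs : MemLp (Function.uncurry s) 2 (μ.prod ν)) :
    ContinuousLinearMap.adjoint (kernelOperator hs) = kernelOperator (memLp_two_swap_kernel hs) := by
  symm
  rw [ContinuousLinearMap.eq_adjoint_iff]
  intro f g
  have hi : Integrable (Function.uncurry fun y x => s y x * (f y * g x)) (μ.prod ν) :=
    hs.integrable_mul (memLp_two_tensor f g)
  have h1 : inner ℝ (kernelOperator (memLp_two_swap_kernel hs) f) g =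
      ∫ x, ∫ y, s y x * (f y * g x) ∂μ ∂ν := by
    rw [L2.inner_def]
    refine integral_congr_ae ?_
    filter_upwards [kernelOperator_ae_eq (memLp_two_swap_kernel hs) f] with x hx
    rw [hx, real_inner_eq_mul, ← integral_mul_const]
    simp only [mul_assoc]
  have h2 : inner ℝ f (kernelOperator hs g) = ∫ y, ∫ x, s y x * (f y * g x) ∂ν ∂μ := by
    rw [L2.inner_def]
    refine integral_congr_ae ?_
    filter_upwards [kernelOperator_ae_eq hs g] with y hy
    rw [hy, real_inner_eq_mul, ← integral_const_mul]
    simp only [mul_left_comm]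
  rw [h1, h2, integral_integral_swap hi]

/-- The operator `S† S`, for `S` with square integrable kernel `s`, is a trace-class operator with
kernel `∫ s(y, x) s(y, x') dμ(y)`. -/
theorem exists_isTraceClass_of_kernel (hs : MemLp (Function.uncurry s) 2 (μ.prod ν)) :
    ∃ Λ : Lp ℝ 2 ν →L[ℝ] Lp ℝ 2 ν, IsTraceClass Λ ∧ ∀ g : Lp ℝ 2 ν, ∀ᵐ x ∂ν,
      Integrable (fun x' => (∫ y, s y x * s y x' ∂μ) * g x') ν ∧
        Λ g x = ∫ x', (∫ y, s y x * s y x' ∂μ) * g x' ∂ν := by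
  refine ⟨_, isTraceClass_adjoint_comp_self (kernelOperator hs)
    fun ι v hv => summable_norm_sq_kernelOperator hs hv, fun g => ?_⟩
  have h1 := kernelOperator_ae_eq (memLp_two_swap_kernel hs) (kernelOperator hs g)
  filter_upwards [h1, ae_memLp_two_section (memLp_two_swap_kernel hs)] with x hx hsx
  -- Fubini is justified at fixed `x` by pairing two square integrable functions of `(y, x')`,
  -- namely `s y x'` and `s y x * g x'`.
  have hi : Integrable (Function.uncurry fun y x' => s y x * s y x' * g x') (μ.prod ν) := by
    have hm : MemLp (fun p : Y × X => s p.1 x * g p.2) 2 (μ.prod ν) := by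
      have hm : AEStronglyMeasurable (fun p : Y × X => s p.1 x * g p.2) (μ.prod ν) :=
        hsx.1.comp_fst.mul (Lp.aestronglyMeasurable g).comp_snd
      rw [memLp_two_iff_integrable_sq hm]
      simp only [mul_pow]
      exact hsx.integrable_sq.mul_prod (Lp.memLp g).integrable_sq
    refine (hs.integrable_mul hm).congr (Filter.Eventually.of_forall fun p => ?_)
    simp only [Pi.mul_apply, Function.uncurry]
    ring
  have hi' := hi.integral_prod_right
  simp only [Function.uncurry, integral_mul_const] at hi'
  refine ⟨hi', ?_⟩
  rw [adjoint_kernelOperator, ContinuousLinearMap.comp_apply, hx]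
  calc ∫ y, s y x * kernelOperator hs g y ∂μ = ∫ y, ∫ x', s y x * s y x' * g x' ∂ν ∂μ := by
        refine integral_congr_ae ?_
        filter_upwards [kernelOperator_ae_eq hs g] with y hy
        simp only [hy, mul_assoc, integral_const_mul]
    _ = ∫ x', ∫ y, s y x * s y x' * g x' ∂μ ∂ν := integral_integral_swap hi
    _ = _ := by simp only [integral_mul_const]

end IntegralOperator

/-! ### Data augmentation chains -/

section DataAugmentation

variable {X Y : Type} [MeasurableSpace X] [MeasurableSpace Y]

/-- The conclusions on the marginal chain with stationary density `q` and transition density `k`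
with respect to `ν`. -/
def IsTraceClassChain (ν : Measure X) (S : Set X) (q : X → ℝ) (k : X → X → ℝ) : Prop :=
  IsProbabilityMeasure (ν.withDensity fun x => ENNReal.ofReal (q x)) ∧
  (∀ x ∈ S, ∫ x', k x x' ∂ν = 1) ∧
  ∃ Λ : Lp ℝ 2 (ν.withDensity fun x => ENNReal.ofReal (q x)) →L[ℝ]
      Lp ℝ 2 (ν.withDensity fun x => ENNReal.ofReal (q x)),
    (∀ g : Lp ℝ 2 (ν.withDensity fun x => ENNReal.ofReal (q x)),
      ∀ᵐ x ∂(ν.withDensity fun x => ENNReal.ofReal (q x)),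
        Integrable (fun x' => k x x' * g x') ν ∧ Λ g x = ∫ x', k x x' * g x' ∂ν) ∧
    IsTraceClass Λ

theorem isProbabilityMeasure_withDensity_div_integral {ν : Measure X} {j : X → ℝ} (hj0 : ∀ x, 0 ≤ j x)
    (hj : Integrable j ν) (hpos : 0 < ∫ x, j x ∂ν) :
    IsProbabilityMeasure (ν.withDensity fun x => ENNReal.ofReal (j x / ∫ x, j x ∂ν)) := by
  refine ⟨?_⟩
  rw [withDensity_apply _ MeasurableSet.univ, Measure.restrict_univ,
    ← ofReal_integral_eq_lintegral_ofReal (hj.div_const _)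
      (Filter.Eventually.of_forall fun x => div_nonneg (hj0 x) hpos.le), integral_div,
    div_self hpos.ne', ENNReal.ofReal_one]

variable {μ : Measure Y} {ν : Measure X} [SFinite μ] [SFinite ν] {J : Y → X → ℝ} {S : Set X}

theorem measurable_integral_left (hm : Measurable (Function.uncurry J)) :
    Measurable fun x => ∫ y, J y x ∂μ :=
  (hm.stronglyMeasurable.integral_prod_left' (μ := μ)).measurable

theorem measurable_integral_right (hm : Measurable (Function.uncurry J)) :
    Measurable fun y => ∫ x, J y x ∂ν :=
  (hm.stronglyMeasurable.integral_prod_right' (ν := ν)).measurable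

theorem integral_transition_eq_one (hm : Measurable (Function.uncurry J)) (h0 : ∀ y x, 0 ≤ J y x)
    (hY : ∀ y, Integrable (J y) ν) (hYpos : ∀ y, 0 < ∫ x, J y x ∂ν) {x : X}
    (hX : Integrable (fun y => J y x) μ) (hXpos : 0 < ∫ y, J y x ∂μ) :
    ∫ x', ∫ y, (J y x' / ∫ x, J y x ∂ν) * (J y x / ∫ y, J y x ∂μ) ∂μ ∂ν = 1 := by
  have hmU := measurable_integral_right (ν := ν) hm
  have hm' : Measurable fun p : Y × X =>
      (J p.1 p.2 / ∫ x, J p.1 x ∂ν) * (J p.1 x / ∫ y, J y x ∂μ) := by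
    have h1 : Measurable fun p : Y × X => J p.1 p.2 := hm
    have h2 : Measurable fun p : Y × X => J p.1 x := by fun_prop
    exact (h1.div (hmU.comp measurable_fst)).mul (h2.div_const _)
  have hin : ∀ y, ∫ x', (J y x' / ∫ x, J y x ∂ν) * (J y x / ∫ y, J y x ∂μ) ∂ν =
      J y x / ∫ y, J y x ∂μ := by
    intro y
    rw [integral_mul_const, integral_div, div_self (hYpos y).ne', one_mul]
  have hi : Integrable (Function.uncurry fun y x' =>
      (J y x' / ∫ x, J y x ∂ν) * (J y x / ∫ y, J y x ∂μ)) (μ.prod ν) := by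
    refine (integrable_prod_iff hm'.aestronglyMeasurable).2
      ⟨Filter.Eventually.of_forall fun y => by
        dsimp only; exact ((hY y).div_const _).mul_const _, ?_⟩
    refine (hX.div_const (∫ y, J y x ∂μ)).congr (Filter.Eventually.of_forall fun y => ?_)
    dsimp only
    refine (hin y).symm.trans (integral_congr_ae (Filter.Eventually.of_forall fun x' => ?_))
    exact (Real.norm_of_nonneg (mul_nonneg (div_nonneg (h0 _ _) (hYpos y).le)
      (div_nonneg (h0 _ _) hXpos.le))).symm
  rw [← integral_integral_swap hi]
  simp only [hin]
  rw [integral_div, div_self hXpos.ne']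

/-- If the joint density `J` has `∬ J² / (J_Y J_X) < ∞`, then the data augmentation chain on `X` is
trace-class. -/
theorem isTraceClassChain_of_lintegral_lt_top
    (hm : Measurable (Function.uncurry J)) (h0 : ∀ y x, 0 ≤ J y x)
    (hY : ∀ y, Integrable (J y) ν) (hYpos : ∀ y, 0 < ∫ x, J y x ∂ν)
    (hS : ∀ᵐ x ∂ν, x ∈ S)
    (hX : ∀ x ∈ S, Integrable (fun y => J y x) μ) (hXpos : ∀ x ∈ S, 0 < ∫ y, J y x ∂μ)
    (hZ : Integrable (fun x => ∫ y, J y x ∂μ) ν) (hZpos : 0 < ∫ x, ∫ y, J y x ∂μ ∂ν)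
    (hHS : ∫⁻ x, ∫⁻ y, ENNReal.ofReal
      (J y x ^ 2 / ((∫ x', J y x' ∂ν) * ∫ y', J y' x ∂μ)) ∂μ ∂ν < ⊤) :
    IsTraceClassChain ν S (fun x => (∫ y, J y x ∂μ) / ∫ x', ∫ y, J y x' ∂μ ∂ν)
      (fun x x' => ∫ y, (J y x' / ∫ x, J y x ∂ν) * (J y x / ∫ y, J y x ∂μ) ∂μ) := by
  have hmU := measurable_integral_right (ν := ν) hm
  have hmV := measurable_integral_left (μ := μ) hm
  set jU : Y → ℝ := fun y => ∫ x, J y x ∂ν with hjU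
  set jV : X → ℝ := fun x => ∫ y, J y x ∂μ with hjV
  set Z : ℝ := ∫ x, ∫ y, J y x ∂μ ∂ν with hZdef
  have hV0 : ∀ x, 0 ≤ jV x := fun x => integral_nonneg fun y => h0 y x
  refine ⟨isProbabilityMeasure_withDensity_div_integral hV0 hZ hZpos,
    fun x hx => integral_transition_eq_one hm h0 hY hYpos (hX x hx) (hXpos x hx), ?_⟩
  have hmq : Measurable fun x => ENNReal.ofReal (jV x / Z) := (hmV.div_const Z).ennreal_ofReal
  set P := ν.withDensity fun x => ENNReal.ofReal (jV x / Z) with hP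
  have hPν : P ≪ ν := withDensity_absolutelyContinuous _ _
  have hPprob : IsProbabilityMeasure P :=
    isProbabilityMeasure_withDensity_div_integral hV0 hZ hZpos
  -- Normalized so that `s y x * s y x'` times the density `jV x' / Z` of `P` equals the integrand
  -- of the transition density, and so that `s²` times that density is `J² / (jU jV)`.
  let s : Y → X → ℝ := fun y x => J y x * √Z / (jV x * √(jU y))
  have hsm : Measurable (Function.uncurry s) := by
    have h1 : Measurable fun p : Y × X => J p.1 p.2 := hm
    exact (h1.mul_const _).div ((hmV.comp measurable_snd).mul
      ((hmU.comp measurable_fst).sqrt))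
  have hs : MemLp (Function.uncurry s) 2 (μ.prod P) := by
    rw [memLp_two_iff_integrable_sq hsm.aestronglyMeasurable]
    refine ⟨(hsm.pow_const 2).aestronglyMeasurable, ?_⟩
    rw [hasFiniteIntegral_iff_ofReal (Filter.Eventually.of_forall fun p => sq_nonneg _),
      lintegral_prod_symm' _ (hsm.pow_const 2).ennreal_ofReal,
      lintegral_withDensity_eq_lintegral_mul₀' hmq.aemeasurable
        ((hsm.pow_const 2).ennreal_ofReal.lintegral_prod_left'.aemeasurable)]
    refine lt_of_le_of_lt (lintegral_mono_ae ?_) hHS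
    filter_upwards [hS] with x hx
    simp only [Pi.mul_apply]
    rw [← lintegral_const_mul' _ _ ENNReal.ofReal_ne_top]
    refine lintegral_mono fun y => ?_
    dsimp only
    rw [← ENNReal.ofReal_mul (div_nonneg (hV0 x) hZpos.le)]
    refine ENNReal.ofReal_le_ofReal (le_of_eq ?_)
    have h1 := hXpos x hx
    have h2 := hYpos y
    change jV x / Z * (J y x * √Z / (jV x * √(jU y))) ^ 2 = J y x ^ 2 / (jU y * jV x)
    change 0 < jV x at h1
    change 0 < jU y at h2
    rw [div_pow, mul_pow, mul_pow, Real.sq_sqrt h2.le, Real.sq_sqrt hZpos.le]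
    field_simp
  obtain ⟨Λ, hΛ, hker⟩ := exists_isTraceClass_of_kernel hs
  refine ⟨Λ, fun g => ?_, hΛ⟩
  filter_upwards [hker g, hPν.ae_le hS] with x hx hxS
  have hpt : ∀ᵐ x' ∂ν, (ENNReal.ofReal (jV x' / Z)).toReal •
      ((∫ y, s y x * s y x' ∂μ) * g x') =
      (∫ y, (J y x' / jU y) * (J y x / jV x) ∂μ) * g x' := by
    filter_upwards [hS] with x' hx'
    rw [ENNReal.toReal_ofReal (div_nonneg (hV0 x') hZpos.le), smul_eq_mul, ← mul_assoc,
      ← integral_const_mul]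
    congr 2
    funext y
    have h1 : 0 < jV x := hXpos x hxS
    have h2 : 0 < jU y := hYpos y
    have h3 : 0 < jV x' := hXpos x' hx'
    have hz := Real.mul_self_sqrt hZpos.le
    have hu := Real.mul_self_sqrt h2.le
    have h4 : s y x * s y x' = J y x * J y x' * (√Z * √Z) / (jV x * jV x' * (√(jU y) * √(jU y))) := by
      simp only [s]
      field_simp
    rw [h4, hz, hu]
    field_simp
  obtain ⟨hx1, hx2⟩ := hx
  rw [integrable_withDensity_iff_integrable_smul' hmq
    (Filter.Eventually.of_forall fun _ => ENNReal.ofReal_lt_top)] at hx1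
  rw [integral_withDensity_eq_integral_toReal_smul hmq
    (Filter.Eventually.of_forall fun _ => ENNReal.ofReal_lt_top)] at hx2
  exact ⟨hx1.congr hpt, hx2.trans (integral_congr_ae hpt)⟩

end DataAugmentation

/-! ### Generalized inverse Gaussian integrals -/

section GIG

/-- The unnormalized density of the law `GIG(l, a, b)`. -/
noncomputable def gigKernel (l a b v : ℝ) : ℝ := v ^ (l - 1) * Real.exp (-(a * v + b / v) / 2)

theorem gigKernel_pos {l a b v : ℝ} (hv : 0 < v) : 0 < gigKernel l a b v :=
  mul_pos (Real.rpow_pos_of_pos hv _) (Real.exp_pos _)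

theorem measurable_gigKernel (l a b : ℝ) : Measurable (gigKernel l a b) := by
  unfold gigKernel
  fun_prop

theorem integrableOn_gigKernel_zero {l a : ℝ} (ha : 0 < a) (hl : 0 < l) :
    IntegrableOn (gigKernel l a 0) (Set.Ioi 0) := by
  have h := integrableOn_rpow_mul_exp_neg_mul_rpow (s := l - 1) (p := 1) (b := a / 2)
    (by linarith) one_pos (by positivity)
  refine h.congr_fun (fun v _ => ?_) measurableSet_Ioi
  simp only [gigKernel, Real.rpow_one, zero_div, add_zero]
  congr 2
  ring

theorem integrableOn_gigKernel {l a b : ℝ} (ha : 0 < a) (hb : 0 < b ∨ (0 ≤ b ∧ 0 < l)) :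
    IntegrableOn (gigKernel l a b) (Set.Ioi 0) := by
  rcases hb with hb | ⟨hb, hl⟩
  -- For `b > 0` the factor `exp(-b/(2v))` is at most a constant times `v^k` for every `k`; taking
  -- `l + k > 0` reduces to a gamma integral.
  · obtain ⟨k, hk⟩ := exists_nat_gt (-l)
    refine Integrable.mono' ((integrableOn_gigKernel_zero (l := l + k) ha
      (by linarith)).const_mul (k.factorial * (2 / b) ^ k))
      (measurable_gigKernel _ _ _).aestronglyMeasurable ?_
    refine (ae_restrict_iff' measurableSet_Ioi).2 (Filter.Eventually.of_forall fun v hv => ?_)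
    have hv : 0 < v := hv
    rw [Real.norm_of_nonneg (gigKernel_pos hv).le]
    have hu : 0 ≤ b / (2 * v) := by positivity
    have h := Real.pow_div_factorial_le_exp _ hu k
    have h1 : Real.exp (-(b / (2 * v))) ≤ k.factorial * (2 / b) ^ k * v ^ k := by
      rw [Real.exp_neg]
      calc (Real.exp (b / (2 * v)))⁻¹ ≤ ((b / (2 * v)) ^ k / k.factorial)⁻¹ := by
            gcongr
        _ = k.factorial * (2 / b) ^ k * v ^ k := by
            rw [inv_div, mul_assoc, ← mul_pow, div_eq_mul_inv, ← inv_pow]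
            congr 2
            field_simp
    have h2 : Real.exp (-(a * v + b / v) / 2) = Real.exp (-(a * v) / 2) * Real.exp (-(b / (2 * v))) := by
      rw [← Real.exp_add]; congr 1; field_simp; ring
    have h3 : v ^ (l + k - 1) = v ^ (l - 1) * v ^ k := by
      rw [← Real.rpow_natCast, ← Real.rpow_add hv]; congr 1; ring
    unfold gigKernel
    rw [h2, h3]
    calc v ^ (l - 1) * (Real.exp (-(a * v) / 2) * Real.exp (-(b / (2 * v))))
        ≤ v ^ (l - 1) * (Real.exp (-(a * v) / 2) * (k.factorial * (2 / b) ^ k * v ^ k)) := by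
          gcongr
      _ = _ := by rw [zero_div, add_zero]; ring
  · refine Integrable.mono' (integrableOn_gigKernel_zero ha hl)
      (measurable_gigKernel _ _ _).aestronglyMeasurable ?_
    refine (ae_restrict_iff' measurableSet_Ioi).2 (Filter.Eventually.of_forall fun v hv => ?_)
    have hv : 0 < v := hv
    rw [Real.norm_of_nonneg (gigKernel_pos hv).le]
    unfold gigKernel
    gcongr

theorem integral_Ioi_pos_of_pos {f : ℝ → ℝ} (hf : IntegrableOn f (Set.Ioi 0))
    (hpos : ∀ v, 0 < v → 0 < f v) : 0 < ∫ v in Set.Ioi 0, f v := by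
  rw [setIntegral_pos_iff_support_of_nonneg_ae _ hf]
  · have : Function.support f ∩ Set.Ioi 0 = Set.Ioi 0 :=
      Set.inter_eq_right.2 fun v hv => (hpos v hv).ne'
    rw [this]
    simp
  · exact (ae_restrict_iff' measurableSet_Ioi).2
      (Filter.Eventually.of_forall fun v hv => (hpos v hv).le)

/-- Powers decay at most exponentially. -/
theorem exists_mul_exp_neg_le_rpow (l : ℝ) {η : ℝ} (hη : 0 < η) :
    ∃ c > 0, ∀ v : ℝ, 1 ≤ v → c * Real.exp (-(η * v)) ≤ v ^ (l - 1) := by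
  obtain ⟨k, hk⟩ := exists_nat_gt (1 - l)
  refine ⟨η ^ k / k.factorial, by positivity, fun v hv => ?_⟩
  have hv0 : 0 < v := by linarith
  have h := Real.pow_div_factorial_le_exp (η * v) (by positivity) k
  have h1 : v ^ (-(k : ℝ)) ≤ v ^ (l - 1) :=
    Real.rpow_le_rpow_of_exponent_le hv (by linarith)
  refine le_trans ?_ h1
  rw [Real.rpow_neg hv0.le, Real.rpow_natCast, Real.exp_neg]
  rw [mul_pow] at h
  rw [← div_eq_mul_inv, div_le_iff₀ (Real.exp_pos _)]
  calc η ^ k / k.factorial = (v ^ k)⁻¹ * (η ^ k * v ^ k / k.factorial) := by field_simp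
    _ ≤ _ := by gcongr

/-- The normalizing constant of `GIG(l, α, b + z²)` decays at most like `exp (-√α |z|)`, up to an
arbitrarily small change of the rate. -/
theorem exists_mul_exp_neg_le_integral_gigKernel (l : ℝ) {α b η : ℝ} (hα : 0 < α) (hb : 0 ≤ b)
    (hη : 0 < η) :
    ∃ c > 0, ∀ z : ℝ, 0 ≤ z → IntegrableOn (gigKernel l α (b + z ^ 2)) (Set.Ioi 0) →
      c * Real.exp (-((1 + η) * √α * z)) ≤ ∫ v in Set.Ioi 0, gigKernel l α (b + z ^ 2) v := by
  obtain ⟨c, hc, hcv⟩ := exists_mul_exp_neg_le_rpow l (η := η * α) (by positivity)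
  have hD : 0 < √α := Real.sqrt_pos.2 hα
  have hD2 : √α * √α = α := Real.mul_self_sqrt hα.le
  set D := √α with hDdef
  have hb2 : √b * √b = b := Real.mul_self_sqrt hb
  have hb0 := Real.sqrt_nonneg b
  set e := √b
  refine ⟨c * Real.exp (-(η * α + (1 + η) * D * (D + e) + α / 2)), by positivity, fun z hz hi => ?_⟩
  -- The exponent `α v + (b + z²)/v` is minimal at `√(b + z²)/D`. The point `s` lies to its right,
  -- stays within a bounded distance of it, and is at least `1`, so that the bound on powers
  -- applies. On the unit interval after `s` the integrand has the required size.
  set s := (D + e + z) / D with hs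
  have hs1 : 1 ≤ s := by rw [hs, le_div_iff₀ hD]; linarith
  have hDs : D * s = D + e + z := by rw [hs]; field_simp
  have hαs : α * s = D * (D + e + z) := by rw [← hDs, ← hD2]; ring
  have hpt : ∀ v ∈ Set.Ioc s (s + 1), c * Real.exp (-(η * α + (1 + η) * D * (D + e) + α / 2)) *
      Real.exp (-((1 + η) * D * z)) ≤ gigKernel l α (b + z ^ 2) v := by
    intro v hv
    have hv1 : 1 ≤ v := hs1.trans hv.1.le
    have hv0 : 0 < v := by linarith
    have h1 := hcv v hv1
    have h2 : (b + z ^ 2) / v ≤ D * (D + e + z) := by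
      rw [div_le_iff₀ hv0]
      have h3 : b + z ^ 2 ≤ (D + e + z) * (D + e + z) := by nlinarith [mul_nonneg hb0 hz]
      calc b + z ^ 2 ≤ (D + e + z) * (D + e + z) := h3
        _ = D * (D + e + z) * s := by rw [mul_right_comm, hDs]
        _ ≤ _ := by
          have := hv.1.le
          gcongr
    have h4 : α * v ≤ D * (D + e + z) + α := by
      have := hv.2
      nlinarith
    unfold gigKernel
    calc _ = c * Real.exp (-(η * α * (s + 1))) *
          Real.exp (-(D * (D + e + z) + α / 2)) := by
          rw [mul_assoc c, mul_assoc c, ← Real.exp_add, ← Real.exp_add]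
          congr 2
          linear_combination η * hαs
      _ ≤ c * Real.exp (-(η * α * v)) * Real.exp (-(α * v + (b + z ^ 2) / v) / 2) := by
          have := hv.2
          gcongr
          linarith
      _ ≤ _ := by gcongr
  calc _ = ∫ v in Set.Ioc s (s + 1), c * Real.exp (-(η * α + (1 + η) * D * (D + e) + α / 2)) *
      Real.exp (-((1 + η) * D * z)) := by simp
    _ ≤ ∫ v in Set.Ioc s (s + 1), gigKernel l α (b + z ^ 2) v := by
        refine setIntegral_mono_on (integrableOn_const (by simp)) (hi.mono_set ?_)
          measurableSet_Ioc hpt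
        exact fun v hv => lt_trans (by linarith) hv.1
    _ ≤ _ := by
        refine setIntegral_mono_set hi ?_ ?_
        · exact (ae_restrict_iff' measurableSet_Ioi).2
            (Filter.Eventually.of_forall fun v hv => (gigKernel_pos hv).le)
        · exact Filter.Eventually.of_forall fun v hv => lt_trans (by linarith) hv.1

/-- Contraction factor `t` for which the ratio of latent densities at `x` and `t x` compensates the
mismatch of the exponential rates. -/
theorem exists_contraction_exponent_le {D q : ℝ} (hD : 0 < D) (hq : 0 ≤ q) (hqD : q < D) :
    ∃ t ∈ Set.Icc (0 : ℝ) 1, ∃ δ > 0, ∀ v W : ℝ, 0 < v → 0 ≤ W →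
      -(D ^ 2 * v + W ^ 2 / v) / 2 - (1 - t ^ 2) * W ^ 2 / (2 * v) + q * (1 - t) * W +
        (1 + δ) * D * W ≤ -(δ * v + δ * W ^ 2 / v) := by
  -- With `t = 1 - ε` and `δ = 0`, the discriminant gap is `2 ε D (D - q) - ε² (D² + q²)`. This `ε`
  -- is half its maximizer, which keeps the gap positive and `ε ≤ 1/2`.
  set ε := D * (D - q) / (2 * (D ^ 2 + q ^ 2)) with hε
  have hden : 0 < 2 * (D ^ 2 + q ^ 2) := by positivity
  have hεeq : ε * (2 * (D ^ 2 + q ^ 2)) = D * (D - q) := by rw [hε]; field_simp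
  have hε0 : 0 < ε := div_pos (mul_pos hD (by linarith)) hden
  have hε1 : ε ≤ 1 / 2 := by
    rw [hε, div_le_iff₀ hden]
    nlinarith [mul_nonneg hD.le hq, sq_nonneg q]
  have hF0 : (q * ε + (1 + 0) * D) ^ 2 < (D ^ 2 - 2 * 0) * (1 + ε * (2 - ε) - 2 * 0) := by
    have : (D ^ 2 - 2 * 0) * (1 + ε * (2 - ε) - 2 * 0) - (q * ε + (1 + 0) * D) ^ 2 =
        ε * (3 / 2 * (D * (D - q))) := by
      linear_combination (-ε / 2) * hεeq
    have h2 : 0 < ε * (3 / 2 * (D * (D - q))) := by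
      have : 0 < D - q := by linarith
      positivity
    linarith
  -- The strict inequality at `δ = 0` persists for small `δ > 0`, which pays for both the loss `1 +
  -- δ` in the rate and the decay kept on the right-hand side.
  have hcont : ∀ᶠ δ in nhds (0 : ℝ),
      (q * ε + (1 + δ) * D) ^ 2 < (D ^ 2 - 2 * δ) * (1 + ε * (2 - ε) - 2 * δ) :=
    ContinuousAt.eventually_lt (by fun_prop) (by fun_prop) hF0
  have h1 : ∀ᶠ δ in nhds (0 : ℝ), 2 * δ < D ^ 2 :=
    ContinuousAt.eventually_lt (by fun_prop) (by fun_prop) (by simpa using pow_pos hD 2)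
  have h2 : ∀ᶠ δ in nhds (0 : ℝ), 2 * δ < 1 :=
    ContinuousAt.eventually_lt (by fun_prop) (by fun_prop) (by simp)
  obtain ⟨δ, ⟨⟨h3, h4⟩, h5⟩, hδ⟩ :=
    ((((hcont.and h1).and h2).filter_mono nhdsWithin_le_nhds).and
      (self_mem_nhdsWithin (a := (0 : ℝ)) (s := Set.Ioi 0))).exists
  have hδ : 0 < δ := hδ
  refine ⟨1 - ε, ⟨by linarith, by linarith⟩, δ, hδ, fun v W hv hW => ?_⟩
  set A := D ^ 2 - 2 * δ
  set B := 1 + ε * (2 - ε) - 2 * δ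
  set c := q * ε + (1 + δ) * D
  have hA : 0 < A := by simp only [A]; linarith
  have hB : 0 < B := by simp only [B]; nlinarith
  have hc : 0 ≤ c := by positivity
  -- Arithmetic–geometric mean: the right side is at least `2 √(AB) W`, and `c² < A B`.
  have key : 2 * (c * W) ≤ A * v + B * (W ^ 2 / v) := by
    refine abs_le_of_sq_le_sq' ?_ (by positivity) |>.2
    have h6 : (A * v + B * (W ^ 2 / v)) ^ 2 = (A * v - B * (W ^ 2 / v)) ^ 2 + 4 * (A * B) * W ^ 2 := by
      field_simp
      ring
    rw [h6]
    nlinarith [sq_nonneg (A * v - B * (W ^ 2 / v)), mul_le_mul_of_nonneg_right h3.le (sq_nonneg W)]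
  have h7 : (1 - (1 - ε) ^ 2) * W ^ 2 / (2 * v) = ε * (2 - ε) * (W ^ 2 / v) / 2 := by
    field_simp
    ring
  rw [h7, mul_div_assoc δ]
  simp only [A, B, c] at key
  linarith

end GIG

/-! ### The joint density of one latent variable and its mixing variable -/

section CoordPDF

/-- The joint density of `(M_i, V_i)`, where `M_i ∣ V_i ∼ N(μ V_i, σ² V_i)`, `V_i ∼ GIG(p, a, b)`. -/
noncomputable def coordPDF (μ σ p a b x v : ℝ) : ℝ :=
  gaussianPDFReal (μ * v) (σ ^ 2 * v).toNNReal x * gigPDF p a b v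

variable {μ σ p a b : ℝ}

theorem gigPDF_eq_div (v : ℝ) :
    gigPDF p a b v = gigKernel p a b v / ∫ t in Set.Ioi 0, gigKernel p a b t := rfl

theorem measurable_gigPDF : Measurable (gigPDF p a b) := by
  have : gigPDF p a b = fun v => gigKernel p a b v / ∫ t in Set.Ioi 0, gigKernel p a b t := rfl
  rw [this]
  exact (measurable_gigKernel p a b).div_const _

theorem measurable_coordPDF : Measurable (Function.uncurry (coordPDF μ σ p a b)) := by
  have h : Measurable fun q : ℝ × ℝ => (μ * q.2, (σ ^ 2 * q.2).toNNReal, q.1) := by fun_prop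
  exact (measurable_uncurry_gaussianPDFReal.comp h).mul (measurable_gigPDF.comp measurable_snd)

theorem integral_gigKernel_pos (ha : 0 < a) (hb : 0 < b ∨ (b = 0 ∧ 1 / 2 < p)) :
    0 < ∫ t in Set.Ioi 0, gigKernel p a b t :=
  integral_Ioi_pos_of_pos (integrableOn_gigKernel ha
    (hb.imp_right fun h => ⟨h.1.ge, by linarith [h.2]⟩)) fun _ hv => gigKernel_pos hv

theorem integrableOn_gigPDF (ha : 0 < a) (hb : 0 < b ∨ (b = 0 ∧ 1 / 2 < p)) :
    IntegrableOn (gigPDF p a b) (Set.Ioi 0) :=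
  (integrableOn_gigKernel ha (hb.imp_right fun h => ⟨h.1.ge, by linarith [h.2]⟩)).div_const _

theorem gigPDF_pos (ha : 0 < a) (hb : 0 < b ∨ (b = 0 ∧ 1 / 2 < p)) {v : ℝ} (hv : 0 < v) :
    0 < gigPDF p a b v :=
  div_pos (gigKernel_pos hv) (integral_gigKernel_pos ha hb)

theorem toNNReal_var_ne_zero (hσ : 0 < σ) {v : ℝ} (hv : 0 < v) : (σ ^ 2 * v).toNNReal ≠ 0 := by
  simpa using mul_pos (pow_pos hσ 2) hv

theorem coordPDF_pos (hσ : 0 < σ) (ha : 0 < a) (hb : 0 < b ∨ (b = 0 ∧ 1 / 2 < p)) (x : ℝ) {v : ℝ}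
    (hv : 0 < v) : 0 < coordPDF μ σ p a b x v :=
  mul_pos (gaussianPDFReal_pos _ _ _ (toNNReal_var_ne_zero hσ hv)) (gigPDF_pos ha hb hv)

/-- The variance truncates to `0`, and `gaussianPDFReal` with variance `0` is the zero function. -/
theorem coordPDF_of_nonpos (x : ℝ) {v : ℝ} (hv : v ≤ 0) : coordPDF μ σ p a b x v = 0 := by
  have : (σ ^ 2 * v).toNNReal = 0 := by
    rw [Real.toNNReal_eq_zero]
    exact mul_nonpos_of_nonneg_of_nonpos (sq_nonneg _) hv
  simp [coordPDF, this]

theorem coordPDF_nonneg (hσ : 0 < σ) (ha : 0 < a) (hb : 0 < b ∨ (b = 0 ∧ 1 / 2 < p)) (x v : ℝ) :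
    0 ≤ coordPDF μ σ p a b x v := by
  rcases le_or_gt v 0 with hv | hv
  · rw [coordPDF_of_nonpos x hv]
  · exact (coordPDF_pos hσ ha hb x hv).le

theorem integrable_coordPDF_left (v : ℝ) : Integrable fun x => coordPDF μ σ p a b x v :=
  (integrable_gaussianPDFReal _ _).mul_const _

theorem integral_coordPDF_left (hσ : 0 < σ) {v : ℝ} (hv : 0 < v) :
    ∫ x, coordPDF μ σ p a b x v = gigPDF p a b v := by
  unfold coordPDF
  rw [integral_mul_const, integral_gaussianPDFReal_eq_one _ (toNNReal_var_ne_zero hσ hv), one_mul]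

/-- Conditionally on `M_i = x`, the variable `V_i` is generalized inverse Gaussian. -/
theorem exists_coordPDF_eq (hσ : 0 < σ) (ha : 0 < a) (hb : 0 < b ∨ (b = 0 ∧ 1 / 2 < p)) :
    ∃ κ > 0, ∀ x v : ℝ, 0 < v → coordPDF μ σ p a b x v =
      κ * gigKernel (p - 1 / 2) (a + (μ / σ) ^ 2) (b + (x / σ) ^ 2) v *
        Real.exp (μ / σ * (x / σ)) := by
  have hG := integral_gigKernel_pos ha hb
  refine ⟨(√(2 * Real.pi * σ ^ 2))⁻¹ / ∫ t in Set.Ioi 0, gigKernel p a b t, by positivity,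
    fun x v hv => ?_⟩
  rw [coordPDF, gigPDF_eq_div, gaussianPDFReal, Real.coe_toNNReal _ (by positivity), gigKernel,
    gigKernel]
  have h1 : √(2 * Real.pi * (σ ^ 2 * v)) = √(2 * Real.pi * σ ^ 2) * v ^ (1 / 2 : ℝ) := by
    rw [← mul_assoc, Real.sqrt_mul (by positivity), ← Real.sqrt_eq_rpow]
  have h2 : v ^ (p - 1 / 2 - 1) = v ^ (p - 1) * (v ^ (1 / 2 : ℝ))⁻¹ := by
    rw [← Real.rpow_neg hv.le, ← Real.rpow_add hv]
    congr 1
    ring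
  have h3 : Real.exp (-(x - μ * v) ^ 2 / (2 * (σ ^ 2 * v))) * Real.exp (-(a * v + b / v) / 2) =
      Real.exp (-((a + (μ / σ) ^ 2) * v + (b + (x / σ) ^ 2) / v) / 2) *
        Real.exp (μ / σ * (x / σ)) := by
    rw [← Real.exp_add, ← Real.exp_add]
    congr 1
    field_simp
    ring
  rw [h1, h2, mul_inv]
  linear_combination ((√(2 * Real.pi * σ ^ 2))⁻¹ * (v ^ (1 / 2 : ℝ))⁻¹ * v ^ (p - 1) /
    ∫ t in Set.Ioi 0, gigKernel p a b t) * h3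

theorem gigKernel_condition (hb : 0 < b ∨ (b = 0 ∧ 1 / 2 < p)) (z : ℝ) :
    0 < b + z ^ 2 ∨ (0 ≤ b + z ^ 2 ∧ 0 < p - 1 / 2) := by
  rcases hb with hb | ⟨rfl, hp⟩
  · left; positivity
  · right; exact ⟨by positivity, by linarith⟩

theorem integrableOn_coordPDF_right (hσ : 0 < σ) (ha : 0 < a)
    (hb : 0 < b ∨ (b = 0 ∧ 1 / 2 < p)) (x : ℝ) :
    IntegrableOn (coordPDF μ σ p a b x) (Set.Ioi 0) := by
  obtain ⟨κ, hκ, h⟩ := exists_coordPDF_eq (μ := μ) hσ ha hb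
  have hi : IntegrableOn (gigKernel (p - 1 / 2) (a + (μ / σ) ^ 2) (b + (x / σ) ^ 2)) (Set.Ioi 0) :=
    integrableOn_gigKernel (by positivity) (gigKernel_condition hb _)
  exact IntegrableOn.congr_fun ((hi.const_mul κ).mul_const (Real.exp (μ / σ * (x / σ))))
    (fun v hv => (h x v hv).symm) measurableSet_Ioi

/-- The parallelogram identity in the exponent. -/
theorem gaussianPDFReal_mul_reflect (m : ℝ) (v : NNReal) (x u : ℝ) :
    gaussianPDFReal m v (x + u) * gaussianPDFReal m v (x - u) =
      (gaussianPDFReal m v x * Real.exp (-(u ^ 2 / (2 * v)))) ^ 2 := by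
  have h : Real.exp (-(x + u - m) ^ 2 / (2 * v)) * Real.exp (-(x - u - m) ^ 2 / (2 * v)) =
      (Real.exp (-(x - m) ^ 2 / (2 * v)) * Real.exp (-(u ^ 2 / (2 * v)))) ^ 2 := by
    rw [← Real.exp_add, ← Real.exp_add, ← Real.exp_nat_mul]
    congr 1
    push_cast
    ring
  unfold gaussianPDFReal
  linear_combination ((√(2 * Real.pi * v))⁻¹ ^ 2) * h

theorem coordPDF_mul_reflect (hσ : 0 < σ) (x u : ℝ) {v : ℝ} (hv : 0 < v) :
    coordPDF μ σ p a b (x + u) v * coordPDF μ σ p a b (x - u) v =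
      (coordPDF μ σ p a b x v * Real.exp (-(1 / (2 * σ ^ 2 * v) * u ^ 2))) ^ 2 := by
  have h := gaussianPDFReal_mul_reflect (μ * v) (σ ^ 2 * v).toNNReal x u
  rw [Real.coe_toNNReal _ (by positivity)] at h
  have h2 : u ^ 2 / (2 * (σ ^ 2 * v)) = 1 / (2 * σ ^ 2 * v) * u ^ 2 := by field_simp
  rw [h2] at h
  unfold coordPDF
  linear_combination (gigPDF p a b v) ^ 2 * h

theorem gigKernel_eq_mul_exp {l α χ c v : ℝ} :
    gigKernel l α (χ + c) v = gigKernel l α χ v * Real.exp (-(c / v) / 2) := by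
  unfold gigKernel
  rw [mul_assoc, ← Real.exp_add]
  congr 2
  ring

/-- The integrable majorant of the one-dimensional factors of the trace integrand. -/
theorem exists_coordPDF_sq_le (hσ : 0 < σ) (ha : 0 < a) (hb : 0 < b ∨ (b = 0 ∧ 1 / 2 < p))
    {C : ℝ} (hC : 0 ≤ C) :
    ∃ t ∈ Set.Icc (0 : ℝ) 1, ∃ B : ℝ → ℝ → ℝ, (∀ x v, 0 < v → 0 ≤ B x v) ∧
      (∀ x v, 0 < v → coordPDF μ σ p a b x v ^ 2 ≤
        B x v * ((∫ v in Set.Ioi 0, coordPDF μ σ p a b x v) *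
          (coordPDF μ σ p a b (t * x) v * √(Real.pi / (C + 1 / (2 * σ ^ 2 * v)))))) ∧
      (∀ v, 0 < v → Integrable fun x => B x v) ∧
      IntegrableOn (fun v => ∫ x, B x v) (Set.Ioi 0) := by
  obtain ⟨κ, hκ, hf⟩ := exists_coordPDF_eq (μ := μ) hσ ha hb
  have hb0 : 0 ≤ b := hb.elim le_of_lt fun h => h.1.ge
  set α := a + (μ / σ) ^ 2 with hα
  have hα0 : 0 < α := by positivity
  have hD : 0 < √α := Real.sqrt_pos.2 hα0
  have hD2 : √α ^ 2 = α := Real.sq_sqrt hα0.le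
  -- Strict because `a > 0`; this is the margin the contraction exploits.
  have hqD : |μ / σ| < √α := by
    rw [Real.lt_sqrt (abs_nonneg _), sq_abs]
    linarith
  obtain ⟨t, ht, δ, hδ, hexp⟩ := exists_contraction_exponent_le hD (abs_nonneg _) hqD
  obtain ⟨c, hc, hG⟩ := exists_mul_exp_neg_le_integral_gigKernel (p - 1 / 2) hα0 hb0 hδ
  -- What remains of `f(x,v)² / (g(x) f(tx,v) r)`, with `g` the marginal and `r` the square root,
  -- once `g` is bounded below and the exponents are combined: the decay `δ v + δ z²/v`, with the
  -- power of `v` and the `b` term untouched.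
  refine ⟨t, ht, fun x v => c⁻¹ * (√(Real.pi / (C + 1 / (2 * σ ^ 2 * v))))⁻¹ *
    gigKernel (p - 1 / 2) (2 * δ) b v * Real.exp (-(δ / (σ ^ 2 * v)) * x ^ 2), ?_, ?_, ?_, ?_⟩
  · intro x v hv
    have := (gigKernel_pos (l := p - 1 / 2) (a := 2 * δ) (b := b) hv).le
    positivity
  · intro x v hv
    have hr : 0 < √(Real.pi / (C + 1 / (2 * σ ^ 2 * v))) := by positivity
    set r := √(Real.pi / (C + 1 / (2 * σ ^ 2 * v)))
    set z := x / σ with hz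
    have hint : ∫ v in Set.Ioi 0, coordPDF μ σ p a b x v =
        κ * (∫ v in Set.Ioi 0, gigKernel (p - 1 / 2) α (b + z ^ 2) v) * Real.exp (μ / σ * z) := by
      rw [← integral_const_mul, ← integral_mul_const]
      exact setIntegral_congr_fun measurableSet_Ioi fun v hv => hf x v hv
    have hG' := hG |z| (abs_nonneg z)
      (integrableOn_gigKernel hα0 (gigKernel_condition hb _))
    rw [sq_abs] at hG'
    have htz : t * x / σ = t * z := by rw [hz]; ring
    -- Passing from `z` to `t z` costs a Gaussian factor in `z` of variance proportional to `v`;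
    -- this factor is the gain from `t < 1`.
    have hk1 : gigKernel (p - 1 / 2) α (b + z ^ 2) v = gigKernel (p - 1 / 2) α (b + (t * z) ^ 2) v *
        Real.exp (-((1 - t ^ 2) * z ^ 2 / (2 * v))) := by
      have : b + z ^ 2 = b + (t * z) ^ 2 + (1 - t ^ 2) * z ^ 2 := by ring
      rw [this, gigKernel_eq_mul_exp]
      congr 2
      field_simp
    have hk2 : gigKernel (p - 1 / 2) α (b + z ^ 2) v * Real.exp (-((1 - t ^ 2) * z ^ 2 / (2 * v))) *
        Real.exp (μ / σ * z - μ / σ * (t * z)) ≤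
        gigKernel (p - 1 / 2) (2 * δ) b v * Real.exp (-(δ / (σ ^ 2 * v)) * x ^ 2) *
          Real.exp (-((1 + δ) * √α * |z|)) := by
      unfold gigKernel
      simp only [mul_assoc]
      refine mul_le_mul_of_nonneg_left ?_ (Real.rpow_nonneg hv.le _)
      simp only [← Real.exp_add]
      refine Real.exp_le_exp.2 ?_
      have h1 := hexp v |z| hv (abs_nonneg z)
      rw [hD2, sq_abs] at h1
      have h2 : μ / σ * z - μ / σ * (t * z) ≤ |μ / σ| * (1 - t) * |z| := by
        have h3 : μ / σ * z ≤ |μ / σ| * |z| := (le_abs_self _).trans (abs_mul _ _).le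
        nlinarith [ht.2]
      have h4 : δ / (σ ^ 2 * v) * x ^ 2 = δ * z ^ 2 / v := by
        rw [hz]; field_simp
      rw [neg_mul, h4, add_div]
      have h5 : 2 * δ * v / 2 = δ * v := by ring
      linarith
    rw [hint, hf x v hv, hf (t * x) v hv, htz]
    set k := gigKernel (p - 1 / 2) α (b + z ^ 2) v
    set k' := gigKernel (p - 1 / 2) α (b + (t * z) ^ 2) v
    have hk' : 0 < k' := gigKernel_pos hv
    set G := ∫ v in Set.Ioi 0, gigKernel (p - 1 / 2) α (b + z ^ 2) v
    set w := gigKernel (p - 1 / 2) (2 * δ) b v * Real.exp (-(δ / (σ ^ 2 * v)) * x ^ 2)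
    have hw : 0 < w := mul_pos (gigKernel_pos hv) (Real.exp_pos _)
    have hE : Real.exp (μ / σ * z) =
        Real.exp (μ / σ * z - μ / σ * (t * z)) * Real.exp (μ / σ * (t * z)) := by
      rw [← Real.exp_add]; congr 1; ring
    calc (κ * k * Real.exp (μ / σ * z)) ^ 2
        = κ ^ 2 * Real.exp (μ / σ * z) * Real.exp (μ / σ * (t * z)) * k' *
          (k * Real.exp (-((1 - t ^ 2) * z ^ 2 / (2 * v))) *
            Real.exp (μ / σ * z - μ / σ * (t * z))) := by
          linear_combination (κ ^ 2 * Real.exp (μ / σ * z) * k) * k * hE +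
            (κ ^ 2 * Real.exp (μ / σ * z) * k * Real.exp (μ / σ * z - μ / σ * (t * z)) *
              Real.exp (μ / σ * (t * z))) * hk1
      _ ≤ κ ^ 2 * Real.exp (μ / σ * z) * Real.exp (μ / σ * (t * z)) * k' *
          (w * Real.exp (-((1 + δ) * √α * |z|))) := by gcongr
      _ = κ ^ 2 * Real.exp (μ / σ * z) * Real.exp (μ / σ * (t * z)) * k' *
          (w * (c⁻¹ * (c * Real.exp (-((1 + δ) * √α * |z|))))) := by
          rw [inv_mul_cancel_left₀ hc.ne']
      _ ≤ κ ^ 2 * Real.exp (μ / σ * z) * Real.exp (μ / σ * (t * z)) * k' *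
          (w * (c⁻¹ * G)) := by gcongr
      _ = c⁻¹ * r⁻¹ * gigKernel (p - 1 / 2) (2 * δ) b v *
          Real.exp (-(δ / (σ ^ 2 * v)) * x ^ 2) * (κ * G * Real.exp (μ / σ * z) *
            (κ * k' * Real.exp (μ / σ * (t * z)) * r)) := by
          simp only [w]
          field_simp
  · intro v hv
    exact (integrable_exp_neg_mul_sq (by positivity)).const_mul _
  -- Integrating out `x` leaves the kernel of index `p - 1/2` times a square root of an affine
  -- function of `v`. Since `√u ≤ u + 1`, the kernels of indices `p - 1/2` and `p + 1/2` suffice,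
  -- and for `b = 0` the first needs `p > 1/2`.
  · have hcond : ∀ l, p - 1 / 2 ≤ l → 0 < b ∨ (0 ≤ b ∧ 0 < l) := fun l hl =>
      hb.imp_right fun h => ⟨hb0, by linarith [h.2]⟩
    have h1 := integrableOn_gigKernel (a := 2 * δ) (by positivity) (hcond (p - 1 / 2) le_rfl)
    have h2 := integrableOn_gigKernel (a := 2 * δ) (by positivity) (hcond (p - 1 / 2 + 1) (by linarith))
    have heq : Set.EqOn (fun v => c⁻¹ * gigKernel (p - 1 / 2) (2 * δ) b v *
        √((C * σ ^ 2 * v + 1 / 2) / δ)) (fun v => ∫ x, c⁻¹ *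
        (√(Real.pi / (C + 1 / (2 * σ ^ 2 * v))))⁻¹ * gigKernel (p - 1 / 2) (2 * δ) b v *
        Real.exp (-(δ / (σ ^ 2 * v)) * x ^ 2)) (Set.Ioi 0) := by
      intro v hv
      have hv : 0 < v := hv
      dsimp only
      rw [integral_const_mul, integral_gaussian]
      have h3 : (√(Real.pi / (C + 1 / (2 * σ ^ 2 * v))))⁻¹ * √(Real.pi / (δ / (σ ^ 2 * v))) =
          √((C * σ ^ 2 * v + 1 / 2) / δ) := by
        rw [← Real.sqrt_inv, ← Real.sqrt_mul (by positivity)]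
        congr 1
        field_simp
      rw [← h3]
      ring
    refine IntegrableOn.congr_fun ?_ heq measurableSet_Ioi
    refine Integrable.mono' ((h2.const_mul (c⁻¹ * (C * σ ^ 2 / δ))).add
      (h1.const_mul (c⁻¹ * (1 / 2 / δ + 1)))) ?_ ?_
    · have := measurable_gigKernel (p - 1 / 2) (2 * δ) b
      exact Measurable.aestronglyMeasurable (by fun_prop)
    · refine (ae_restrict_iff' measurableSet_Ioi).2 (Filter.Eventually.of_forall fun v hv => ?_)
      have hv : 0 < v := hv
      have hk := gigKernel_pos (l := p - 1 / 2) (a := 2 * δ) (b := b) hv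
      have hk1 : gigKernel (p - 1 / 2 + 1) (2 * δ) b v = v * gigKernel (p - 1 / 2) (2 * δ) b v := by
        unfold gigKernel
        rw [show p - 1 / 2 + 1 - 1 = p - 1 / 2 - 1 + 1 by ring, Real.rpow_add_one hv.ne']
        ring
      rw [Real.norm_of_nonneg (by positivity), Pi.add_apply, hk1]
      set k := gigKernel (p - 1 / 2) (2 * δ) b v
      set u := (C * σ ^ 2 * v + 1 / 2) / δ with hu
      have hu0 : 0 ≤ u := by positivity
      have h4 : √u ≤ u + 1 := by
        nlinarith [Real.sq_sqrt hu0, sq_nonneg (√u - 1), Real.sqrt_nonneg u]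
      calc c⁻¹ * k * √u ≤ c⁻¹ * k * (u + 1) := by gcongr
        _ = _ := by rw [hu]; ring

end CoordPDF

/-! ### The Gaussian likelihood: contraction and reflection -/

section LinearLikelihood

variable {m n : ℕ} (c : Fin m → ℝ) (B : Matrix (Fin m) (Fin n) ℝ) (v : NNReal) (y : Fin m → ℝ)

/-- Density at `y` of the Gaussian law `N(c + B M, v I)`. -/
noncomputable def linearLikelihood (M : Fin n → ℝ) : ℝ :=
  ∏ j, gaussianPDFReal (c j + B.mulVec M j) v (y j)

theorem gaussianPDFReal_le (m : ℝ) (v : NNReal) (x : ℝ) :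
    gaussianPDFReal m v x ≤ (√(2 * Real.pi * v))⁻¹ := by
  unfold gaussianPDFReal
  refine mul_le_of_le_one_right (by positivity) (Real.exp_le_one_iff.2 ?_)
  rw [neg_div]
  exact neg_nonpos.2 (by positivity)

variable {v} in
theorem linearLikelihood_pos (hv : v ≠ 0) (M : Fin n → ℝ) : 0 < linearLikelihood c B v y M :=
  Finset.prod_pos fun _ _ => gaussianPDFReal_pos _ _ _ hv

theorem linearLikelihood_le (M : Fin n → ℝ) :
    linearLikelihood c B v y M ≤ ∏ _j : Fin m, (√(2 * Real.pi * v))⁻¹ :=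
  Finset.prod_le_prod (fun _ _ => gaussianPDFReal_nonneg _ _ _) fun _ _ => gaussianPDFReal_le _ _ _

theorem continuous_linearLikelihood : Continuous (linearLikelihood c B v y) := by
  unfold linearLikelihood gaussianPDFReal
  refine continuous_finsetProd _ fun j _ => ?_
  have h : Continuous fun M : Fin n → ℝ => B.mulVec M j :=
    (continuous_apply j).comp (continuous_const.matrix_mulVec continuous_id)
  fun_prop

/-- With `w = y - c`, the residual `w - t u` is a convex combination of `w` and `w - u`, so its
square is at most `w² + (w - u)²`. The constant is independent of `u`, which lets the likelihood
cancel uniformly in the latent variable. -/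
theorem gaussianPDFReal_le_mul_of_contraction (c u : ℝ) (v : NNReal) (y : ℝ) {t : ℝ}
    (ht : t ∈ Set.Icc (0 : ℝ) 1) :
    gaussianPDFReal (c + u) v y ≤
      Real.exp ((y - c) ^ 2 / (2 * v)) * gaussianPDFReal (c + t * u) v y := by
  unfold gaussianPDFReal
  rw [mul_left_comm, ← Real.exp_add, ← add_div]
  gcongr
  obtain ⟨h0, h1⟩ := ht
  have h2 : 0 ≤ (1 - t) * (u - (y - c)) ^ 2 := mul_nonneg (by linarith) (sq_nonneg _)
  have h3 : 0 ≤ t * (y - c) ^ 2 := mul_nonneg h0 (sq_nonneg _)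
  have h4 : 0 ≤ t * (1 - t) * u ^ 2 := mul_nonneg (mul_nonneg h0 (by linarith)) (sq_nonneg _)
  nlinarith

theorem linearLikelihood_le_mul_of_contraction {t : ℝ} (ht : t ∈ Set.Icc (0 : ℝ) 1)
    (M : Fin n → ℝ) : linearLikelihood c B v y M ≤
      (∏ j, Real.exp ((y j - c j) ^ 2 / (2 * v))) * linearLikelihood c B v y (t • M) := by
  unfold linearLikelihood
  rw [← Finset.prod_mul_distrib]
  refine Finset.prod_le_prod (fun _ _ => gaussianPDFReal_nonneg _ _ _) fun j _ => ?_
  rw [Matrix.mulVec_smul, Pi.smul_apply, smul_eq_mul]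
  exact gaussianPDFReal_le_mul_of_contraction _ _ _ _ ht

theorem exists_sq_linearLikelihood_le_reflect :
    ∃ C : ℝ, 0 ≤ C ∧ ∀ N ξ : Fin n → ℝ,
      (linearLikelihood c B v y N * ∏ i, Real.exp (-(C * ξ i ^ 2))) ^ 2 ≤
        linearLikelihood c B v y (N + ξ) * linearLikelihood c B v y (N - ξ) := by
  -- Reflection produces the quadratic form `‖B ξ‖² / (2v)`. Cauchy–Schwarz row by row replaces it
  -- by the multiple `C ‖ξ‖²`, which is diagonal, so the later Gaussian integral factorizes.
  refine ⟨∑ j, (∑ i, B j i ^ 2) / (2 * v), Finset.sum_nonneg fun j _ => div_nonneg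
    (Finset.sum_nonneg fun i _ => sq_nonneg _) (by positivity), fun N ξ => ?_⟩
  have h1 : linearLikelihood c B v y (N + ξ) * linearLikelihood c B v y (N - ξ) =
      (linearLikelihood c B v y N * ∏ j, Real.exp (-(B.mulVec ξ j ^ 2 / (2 * v)))) ^ 2 := by
    unfold linearLikelihood
    rw [← Finset.prod_mul_distrib, ← Finset.prod_mul_distrib, ← Finset.prod_pow]
    refine Finset.prod_congr rfl fun j _ => ?_
    rw [Matrix.mulVec_add, Matrix.mulVec_sub, Pi.add_apply, Pi.sub_apply,
      ← gaussianPDFReal_mul_reflect, mul_comm, ← add_assoc, ← add_sub_assoc]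
    congr 1 <;> · unfold gaussianPDFReal; ring_nf
  have h0 : 0 ≤ linearLikelihood c B v y N :=
    Finset.prod_nonneg fun _ _ => gaussianPDFReal_nonneg _ _ _
  rw [h1, ← Real.exp_sum, ← Real.exp_sum]
  gcongr
  rw [Finset.sum_neg_distrib, Finset.sum_neg_distrib, neg_le_neg_iff, ← Finset.mul_sum,
    Finset.sum_mul]
  refine Finset.sum_le_sum fun j _ => ?_
  rw [div_mul_eq_mul_div]
  gcongr
  exact Finset.sum_mul_sq_le_sq_mul_sq Finset.univ (B j) ξ

end LinearLikelihood

/-! ### Product integrals over the orthant -/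

section Orthant

variable {n : ℕ}

theorem orthant_eq_pi : orthant n = Set.univ.pi fun _ => Set.Ioi (0 : ℝ) := by
  ext V
  simp [orthant]

theorem measurableSet_orthant : MeasurableSet (orthant n) := by
  rw [orthant_eq_pi]
  exact MeasurableSet.univ_pi fun _ => measurableSet_Ioi

theorem volume_restrict_orthant : (volume : Measure (Fin n → ℝ)).restrict (orthant n) =
    Measure.pi fun _ => (volume : Measure ℝ).restrict (Set.Ioi 0) := by
  rw [orthant_eq_pi, volume_pi, Measure.restrict_pi_pi]

theorem volume_orthant_pos : 0 < volume (orthant n) := by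
  have h : IsOpen (orthant n) := by
    rw [orthant_eq_pi]
    exact isOpen_set_pi Set.finite_univ fun _ _ => isOpen_Ioi
  exact h.measure_pos volume ⟨fun _ => 1, fun _ => one_pos⟩

theorem integrableOn_orthant_prod {f : Fin n → ℝ → ℝ} (hf : ∀ i, IntegrableOn (f i) (Set.Ioi 0)) :
    IntegrableOn (fun V : Fin n → ℝ => ∏ i, f i (V i)) (orthant n) := by
  rw [IntegrableOn, volume_restrict_orthant]
  exact Integrable.fintype_prod_dep hf

theorem setIntegral_orthant_prod (f : Fin n → ℝ → ℝ) :
    ∫ V in orthant n, ∏ i, f i (V i) = ∏ i, ∫ x in Set.Ioi 0, f i x := by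
  rw [volume_restrict_orthant]
  exact integral_fintype_prod_eq_prod f

theorem ae_restrict_orthant : ∀ᵐ V ∂(volume : Measure (Fin n → ℝ)).restrict (orthant n),
    V ∈ orthant n := ae_restrict_mem measurableSet_orthant

end Orthant

/-! ### The joint density in the non-centered parameterization -/

section Joint

variable {m n : ℕ} (c : Fin m → ℝ) (B : Matrix (Fin m) (Fin n) ℝ) (v : NNReal) (y : Fin m → ℝ)
  (μ σ p a b : ℝ)

/-- The joint density of `(Y, M, V)` in the non-centered parameterization. -/
noncomputable def latentJoint (M V : Fin n → ℝ) : ℝ :=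
  linearLikelihood c B v y M * ∏ i, coordPDF μ σ p a b (M i) (V i)

theorem measurable_latentJoint :
    Measurable (Function.uncurry (latentJoint c B v y μ σ p a b)) := by
  refine ((continuous_linearLikelihood c B v y).measurable.comp measurable_fst).mul
    (Finset.measurable_prod _ fun i _ => ?_)
  have h : Measurable fun q : (Fin n → ℝ) × (Fin n → ℝ) => (q.1 i, q.2 i) := by fun_prop
  exact measurable_coordPDF.comp h

variable {v μ σ p a b}

theorem integrable_latentJoint_left (V : Fin n → ℝ) :
    Integrable fun M => latentJoint c B v y μ σ p a b M V := by
  refine Integrable.bdd_mul (c := ∏ _j : Fin m, (√(2 * Real.pi * v))⁻¹)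
    (Integrable.fintype_prod_dep fun i => integrable_coordPDF_left (V i))
    (continuous_linearLikelihood c B v y).aestronglyMeasurable
    (Filter.Eventually.of_forall fun M => ?_)
  rw [Real.norm_of_nonneg
    (show 0 ≤ linearLikelihood c B v y M from Finset.prod_nonneg fun _ _ => gaussianPDFReal_nonneg _ _ _)]
  exact linearLikelihood_le c B v y M

theorem setIntegral_latentJoint (M : Fin n → ℝ) :
    ∫ V in orthant n, latentJoint c B v y μ σ p a b M V =
      linearLikelihood c B v y M * ∏ i, ∫ x in Set.Ioi 0, coordPDF μ σ p a b (M i) x := by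
  unfold latentJoint
  rw [integral_const_mul, setIntegral_orthant_prod]

variable (hσ : 0 < σ) (ha : 0 < a) (hb : 0 < b ∨ (b = 0 ∧ 1 / 2 < p))
include hσ ha hb

theorem latentJoint_nonneg (M V : Fin n → ℝ) : 0 ≤ latentJoint c B v y μ σ p a b M V :=
  mul_nonneg (Finset.prod_nonneg fun _ _ => gaussianPDFReal_nonneg _ _ _)
    (Finset.prod_nonneg fun _ _ => coordPDF_nonneg hσ ha hb _ _)

theorem integrableOn_latentJoint_right (M : Fin n → ℝ) :
    IntegrableOn (latentJoint c B v y μ σ p a b M) (orthant n) :=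
  (integrableOn_orthant_prod fun i => integrableOn_coordPDF_right hσ ha hb (M i)).const_mul _

theorem integral_latentJoint_le {V : Fin n → ℝ} (hV : V ∈ orthant n) :
    ∫ M, latentJoint c B v y μ σ p a b M V ≤
      (∏ _j : Fin m, (√(2 * Real.pi * v))⁻¹) * ∏ i, gigPDF p a b (V i) := by
  have h : ∏ i, gigPDF p a b (V i) = ∫ M : Fin n → ℝ, ∏ i, coordPDF μ σ p a b (M i) (V i) := by
    rw [integral_fintype_prod_volume_eq_prod fun i x => coordPDF μ σ p a b x (V i)]
    exact Finset.prod_congr rfl fun i _ => (integral_coordPDF_left hσ (hV i)).symm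
  rw [h, ← integral_const_mul]
  refine integral_mono (integrable_latentJoint_left c B y V)
    ((Integrable.fintype_prod_dep fun i => integrable_coordPDF_left (V i)).const_mul _) fun M => ?_
  exact mul_le_mul_of_nonneg_right (linearLikelihood_le c B v y M)
    (Finset.prod_nonneg fun _ _ => coordPDF_nonneg hσ ha hb _ _)

/-- Lower bound for the marginal density of `V`, from the symmetric average of the joint density
about an arbitrary point `N`. -/
theorem latentJoint_mul_le_integral {C : ℝ} (hC : 0 ≤ C)
    (hrefl : ∀ N ξ : Fin n → ℝ,
      (linearLikelihood c B v y N * ∏ i, Real.exp (-(C * ξ i ^ 2))) ^ 2 ≤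
        linearLikelihood c B v y (N + ξ) * linearLikelihood c B v y (N - ξ))
    (N : Fin n → ℝ) {V : Fin n → ℝ} (hV : V ∈ orthant n) :
    latentJoint c B v y μ σ p a b N V * ∏ i, √(Real.pi / (C + 1 / (2 * σ ^ 2 * V i))) ≤
      ∫ M, latentJoint c B v y μ σ p a b M V := by
  set F : (Fin n → ℝ) → ℝ := fun M => latentJoint c B v y μ σ p a b M V with hF
  have hF0 : ∀ M, 0 ≤ F M := fun M => latentJoint_nonneg c B y hσ ha hb M V
  have hFi : Integrable F := integrable_latentJoint_left c B y V
  have hq : ∀ i, 0 < C + 1 / (2 * σ ^ 2 * V i) := fun i => by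
    have := hV i
    positivity
  let E : (Fin n → ℝ) → ℝ := fun ξ => ∏ i, Real.exp (-(C + 1 / (2 * σ ^ 2 * V i)) * ξ i ^ 2)
  have hE0 : ∀ ξ, 0 ≤ E ξ := fun ξ => Finset.prod_nonneg fun _ _ => (Real.exp_pos _).le
  have hEi : Integrable E := Integrable.fintype_prod_dep
    (f := fun i x => Real.exp (-(C + 1 / (2 * σ ^ 2 * V i)) * x ^ 2))
    fun i => integrable_exp_neg_mul_sq (hq i)
  have hE : ∫ ξ, E ξ = ∏ i, √(Real.pi / (C + 1 / (2 * σ ^ 2 * V i))) := by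
    rw [integral_fintype_prod_volume_eq_prod
      fun i x => Real.exp (-(C + 1 / (2 * σ ^ 2 * V i)) * x ^ 2)]
    exact Finset.prod_congr rfl fun i _ => integral_gaussian _
  have hsq : ∀ ξ, (F N * E ξ) ^ 2 ≤ F (N + ξ) * F (N - ξ) := by
    intro ξ
    have h1 : F (N + ξ) * F (N - ξ) =
        linearLikelihood c B v y (N + ξ) * linearLikelihood c B v y (N - ξ) *
          (∏ i, coordPDF μ σ p a b (N i) (V i) *
            Real.exp (-(1 / (2 * σ ^ 2 * V i) * ξ i ^ 2))) ^ 2 := by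
      simp only [hF, latentJoint]
      rw [mul_mul_mul_comm, ← Finset.prod_mul_distrib, ← Finset.prod_pow]
      congr 1
      exact Finset.prod_congr rfl fun i _ => coordPDF_mul_reflect hσ _ _ (hV i)
    have h2 : F N * E ξ = linearLikelihood c B v y N * (∏ i, Real.exp (-(C * ξ i ^ 2))) *
        ∏ i, coordPDF μ σ p a b (N i) (V i) *
          Real.exp (-(1 / (2 * σ ^ 2 * V i) * ξ i ^ 2)) := by
      simp only [hF, latentJoint, E]
      rw [mul_assoc, mul_assoc, ← Finset.prod_mul_distrib, ← Finset.prod_mul_distrib]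
      congr 1
      refine Finset.prod_congr rfl fun i _ => ?_
      rw [mul_left_comm, ← Real.exp_add]
      congr 2
      ring
    rw [h1, h2, mul_pow]
    exact mul_le_mul_of_nonneg_right (hrefl N ξ) (sq_nonneg _)
  -- The arithmetic mean dominates the geometric mean of the two reflected values. Integrated over
  -- `ξ`, each reflected term has the same integral as `F`, whatever `N` is.
  have hpt : ∀ ξ, F N * E ξ ≤ (F (N + ξ) + F (N - ξ)) / 2 := by
    intro ξ
    refine abs_le_of_sq_le_sq' ?_ (by linarith [hF0 (N + ξ), hF0 (N - ξ)]) |>.2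
    nlinarith [hsq ξ, sq_nonneg (F (N + ξ) - F (N - ξ))]
  have hi1 : Integrable fun ξ => F (N + ξ) := hFi.comp_add_left N
  have hi2 : Integrable fun ξ => F (N - ξ) := hFi.comp_sub_left N
  calc F N * ∏ i, √(Real.pi / (C + 1 / (2 * σ ^ 2 * V i))) = ∫ ξ, F N * E ξ := by
        rw [integral_const_mul, hE]
    _ ≤ ∫ ξ, (F (N + ξ) + F (N - ξ)) / 2 :=
        integral_mono (hEi.const_mul _) ((hi1.add hi2).div_const _) hpt
    _ = ∫ M, F M := by
        rw [integral_div, integral_add hi1 hi2, integral_add_left_eq_self,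
          integral_sub_left_eq_self]
        ring

theorem integral_coordPDF_right_pos (x : ℝ) : 0 < ∫ v in Set.Ioi 0, coordPDF μ σ p a b x v :=
  integral_Ioi_pos_of_pos (integrableOn_coordPDF_right hσ ha hb x)
    fun _ hv => coordPDF_pos hσ ha hb x hv

theorem integrableOn_integral_latentJoint :
    IntegrableOn (fun V => ∫ M, latentJoint c B v y μ σ p a b M V) (orthant n) := by
  refine Integrable.mono' ((integrableOn_orthant_prod fun _ => integrableOn_gigPDF ha hb).const_mul
    (∏ _j : Fin m, (√(2 * Real.pi * v))⁻¹))
    (measurable_integral_left (measurable_latentJoint c B v y μ σ p a b)).aestronglyMeasurable ?_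
  filter_upwards [ae_restrict_orthant] with V hV
  rw [Real.norm_of_nonneg (integral_nonneg fun M => latentJoint_nonneg c B y hσ ha hb M V)]
  exact integral_latentJoint_le c B y hσ ha hb hV

variable (hv : v ≠ 0)
include hv

theorem latentJoint_pos (M : Fin n → ℝ) {V : Fin n → ℝ} (hV : V ∈ orthant n) :
    0 < latentJoint c B v y μ σ p a b M V :=
  mul_pos (linearLikelihood_pos c B y hv M)
    (Finset.prod_pos fun i _ => coordPDF_pos hσ ha hb _ (hV i))

theorem setIntegral_latentJoint_pos (M : Fin n → ℝ) :
    0 < ∫ V in orthant n, latentJoint c B v y μ σ p a b M V := by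
  rw [setIntegral_latentJoint c B y]
  exact mul_pos (linearLikelihood_pos c B y hv M)
    (Finset.prod_pos fun i _ => integral_coordPDF_right_pos hσ ha hb _)

/-- The reflection bound about `N = 0` already has a positive left-hand side. -/
theorem integral_latentJoint_pos {V : Fin n → ℝ} (hV : V ∈ orthant n) :
    0 < ∫ M, latentJoint c B v y μ σ p a b M V := by
  obtain ⟨C, hC, hrefl⟩ := exists_sq_linearLikelihood_le_reflect c B v y
  refine lt_of_lt_of_le ?_ (latentJoint_mul_le_integral c B y hσ ha hb hC hrefl 0 hV)
  refine mul_pos (latentJoint_pos c B y hσ ha hb hv 0 hV) (Finset.prod_pos fun i _ => ?_)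
  have := hV i
  positivity

theorem lintegral_sq_latentJoint_div_lt_top :
    ∫⁻ V in orthant n, ∫⁻ M, ENNReal.ofReal (latentJoint c B v y μ σ p a b M V ^ 2 /
      ((∫ V' in orthant n, latentJoint c B v y μ σ p a b M V') *
        ∫ M', latentJoint c B v y μ σ p a b M' V)) < ⊤ := by
  obtain ⟨C, hC, hrefl⟩ := exists_sq_linearLikelihood_le_reflect c B v y
  obtain ⟨t, ht, D, hD0, hD, hDi, hDI⟩ := exists_coordPDF_sq_le (μ := μ) hσ ha hb hC
  set k := ∏ j, Real.exp ((y j - c j) ^ 2 / (2 * v))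
  have hk : 0 < k := Finset.prod_pos fun _ _ => Real.exp_pos _
  have hpt : ∀ V ∈ orthant n, ∀ M, latentJoint c B v y μ σ p a b M V ^ 2 /
      ((∫ V' in orthant n, latentJoint c B v y μ σ p a b M V') *
        ∫ M', latentJoint c B v y μ σ p a b M' V) ≤ k * ∏ i, D (M i) (V i) := by
    intro V hV M
    have hU := setIntegral_latentJoint_pos c B y hσ ha hb hv (μ := μ) M
    have hVp := integral_latentJoint_pos c B y hσ ha hb hv (μ := μ) hV
    rw [div_le_iff₀ (mul_pos hU hVp)]
    have hL := linearLikelihood_pos c B y hv M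
    -- The center is the contracted point `t • M`: one factor of the likelihood at `M` cancels
    -- against the marginal of `M`, the other against the likelihood at `t • M`, and only
    -- one-dimensional factors remain.
    have hlow := latentJoint_mul_le_integral (μ := μ) c B y hσ ha hb hC hrefl (t • M) hV
    have hDnn : 0 ≤ ∏ i, D (M i) (V i) := Finset.prod_nonneg fun i _ => hD0 _ _ (hV i)
    have hprod : ∏ i, coordPDF μ σ p a b (M i) (V i) ^ 2 ≤ ∏ i, (D (M i) (V i) *
        ((∫ v in Set.Ioi 0, coordPDF μ σ p a b (M i) v) *
          (coordPDF μ σ p a b (t * M i) (V i) * √(Real.pi / (C + 1 / (2 * σ ^ 2 * V i)))))) :=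
      Finset.prod_le_prod (fun _ _ => sq_nonneg _) fun i _ => hD _ _ (hV i)
    simp only [Finset.prod_mul_distrib] at hprod
    have hc := linearLikelihood_le_mul_of_contraction c B v y ht M
    have hf0 : 0 ≤ ∏ i, coordPDF μ σ p a b (M i) (V i) ^ 2 :=
      Finset.prod_nonneg fun _ _ => sq_nonneg _
    have hLt := linearLikelihood_pos c B y hv (t • M)
    calc latentJoint c B v y μ σ p a b M V ^ 2
        = linearLikelihood c B v y M * linearLikelihood c B v y M *
          ∏ i, coordPDF μ σ p a b (M i) (V i) ^ 2 := by
          rw [latentJoint, mul_pow, Finset.prod_pow]; ring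
      _ ≤ linearLikelihood c B v y M * (k * linearLikelihood c B v y (t • M)) *
          ((∏ i, D (M i) (V i)) * ((∏ i, ∫ v in Set.Ioi 0, coordPDF μ σ p a b (M i) v) *
            ((∏ i, coordPDF μ σ p a b (t * M i) (V i)) *
              ∏ i, √(Real.pi / (C + 1 / (2 * σ ^ 2 * V i)))))) := by gcongr
      _ = k * (∏ i, D (M i) (V i)) * ((∫ V' in orthant n, latentJoint c B v y μ σ p a b M V') *
          (latentJoint c B v y μ σ p a b (t • M) V *
            ∏ i, √(Real.pi / (C + 1 / (2 * σ ^ 2 * V i))))) := by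
          rw [setIntegral_latentJoint c B y, latentJoint]
          simp only [Pi.smul_apply, smul_eq_mul]
          ring
      _ ≤ _ := by gcongr
  calc _ ≤ ∫⁻ V in orthant n, ENNReal.ofReal (k * ∏ i, ∫ x, D x (V i)) := by
        refine setLIntegral_mono_ae' measurableSet_orthant
          (Filter.Eventually.of_forall fun V hV => ?_)
        have hi : Integrable fun M : Fin n → ℝ => k * ∏ i, D (M i) (V i) :=
          (Integrable.fintype_prod_dep (f := fun i x => D x (V i))
            fun i => hDi _ (hV i)).const_mul _
        rw [← integral_fintype_prod_volume_eq_prod fun i x => D x (V i), ← integral_const_mul,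
          ofReal_integral_eq_lintegral_ofReal hi (Filter.Eventually.of_forall fun M =>
            mul_nonneg hk.le (Finset.prod_nonneg fun i _ => hD0 _ _ (hV i)))]
        exact lintegral_mono fun M => ENNReal.ofReal_le_ofReal (hpt V hV M)
    _ < ⊤ := ((integrableOn_orthant_prod fun _ => hDI).const_mul k).lintegral_lt_top

theorem setIntegral_integral_latentJoint_pos :
    0 < ∫ V in orthant n, ∫ M, latentJoint c B v y μ σ p a b M V := by
  rw [setIntegral_pos_iff_support_of_nonneg_ae
    (Filter.Eventually.of_forall fun V => integral_nonneg fun M =>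
      latentJoint_nonneg c B y hσ ha hb M V)
    (integrableOn_integral_latentJoint c B y hσ ha hb)]
  have : Function.support (fun V => ∫ M, latentJoint c B v y μ σ p a b M V) ∩ orthant n =
      orthant n :=
    Set.inter_eq_right.2 fun V hV => (integral_latentJoint_pos c B y hσ ha hb hv hV).ne'
  rw [this]
  exact volume_orthant_pos

theorem isTraceClassChain_latentJoint :
    IsTraceClassChain (volume.restrict (orthant n)) (orthant n)
      (fun V => (∫ M, latentJoint c B v y μ σ p a b M V) /
        ∫ V' in orthant n, ∫ M, latentJoint c B v y μ σ p a b M V')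
      (fun V V' => ∫ M, (latentJoint c B v y μ σ p a b M V' /
        ∫ V in orthant n, latentJoint c B v y μ σ p a b M V) *
          (latentJoint c B v y μ σ p a b M V / ∫ M, latentJoint c B v y μ σ p a b M V)) :=
  isTraceClassChain_of_lintegral_lt_top (measurable_latentJoint c B v y μ σ p a b)
    (latentJoint_nonneg c B y hσ ha hb) (integrableOn_latentJoint_right c B y hσ ha hb)
    (setIntegral_latentJoint_pos c B y hσ ha hb hv) ae_restrict_orthant
    (fun V _ => integrable_latentJoint_left c B y V)
    (fun _ hV => integral_latentJoint_pos c B y hσ ha hb hv hV)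
    (integrableOn_integral_latentJoint c B y hσ ha hb)
    (setIntegral_integral_latentJoint_pos c B y hσ ha hb hv)
    (lintegral_sq_latentJoint_div_lt_top c B y hσ ha hb hv)

end Joint

/-! ### Reduction of the model to the non-centered joint density -/

/-- Change of variables `M = K W + r`. -/
theorem integral_abs_det_mul_comp_affine {n : ℕ} {K : Matrix (Fin n) (Fin n) ℝ} (hK : IsUnit K)
    (r : Fin n → ℝ) (F : (Fin n → ℝ) → ℝ) :
    ∫ W, |K.det| * F (K.mulVec W + r) = ∫ M, F M := by
  have hdet : K.det ≠ 0 := ((Matrix.isUnit_iff_isUnit_det K).1 hK).ne_zero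
  have hmap := Real.map_matrix_volume_pi_eq_smul_volume_pi hdet
  -- An injective continuous linear map is a measurable embedding here, so the integral transforms
  -- without any regularity of `F`.
  have hemb : MeasurableEmbedding (Matrix.toLin' K) :=
    (LinearMap.continuous_of_finiteDimensional _).measurableEmbedding
      (Matrix.mulVec_injective_of_isUnit hK)
  rw [integral_const_mul]
  calc |K.det| * ∫ W, F (K.mulVec W + r)
      = |K.det| * ∫ M, F (M + r) ∂(Measure.map (Matrix.toLin' K) volume) := by
        rw [hemb.integral_map]
        simp only [Matrix.toLin'_apply]
    _ = ∫ M, F (M + r) := by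
        rw [hmap, integral_smul_measure, ENNReal.toReal_ofReal (abs_nonneg _), abs_inv, smul_eq_mul,
          mul_inv_cancel_left₀ (abs_ne_zero.2 hdet)]
    _ = ∫ M, F M := integral_add_right_eq_self _ _

namespace LLnGM

variable {m n d : ℕ} (L : LLnGM m n d) (y : Fin m → ℝ)

theorem jointPDF_nonCentered_eq : L.jointPDF y .nonCentered =
    latentJoint (L.X.mulVec L.β - (L.A * L.K⁻¹).mulVec (L.μ • L.h)) (L.A * L.K⁻¹)
      (L.σε ^ 2).toNNReal y L.μ L.σ L.p L.a L.b := by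
  funext M V
  simp only [jointPDF, latentJoint, dataPDF, fieldPDFNonCentered, mixPDF, linearLikelihood,
    coordPDF, Finset.prod_mul_distrib, mul_assoc]
  congr 1
  refine Finset.prod_congr rfl fun j _ => ?_
  congr 1
  rw [Matrix.mulVec_mulVec, Matrix.mulVec_sub]
  simp only [Pi.add_apply, Pi.sub_apply]
  ring

theorem jointPDF_centered_eq (W V : Fin n → ℝ) : L.jointPDF y .centered W V =
    |L.K.det| * L.jointPDF y .nonCentered (L.K.mulVec W + L.μ • L.h) V := by
  have hdet : IsUnit L.K.det := (Matrix.isUnit_iff_isUnit_det L.K).1 L.K_invertible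
  have h1 : L.K⁻¹.mulVec (L.K.mulVec W + L.μ • L.h - L.μ • L.h) = W := by
    rw [add_sub_cancel_right, Matrix.mulVec_mulVec, Matrix.nonsing_inv_mul _ hdet,
      Matrix.one_mulVec]
  have h2 : ∀ i, gaussianPDFReal (L.μ * V i - L.μ * L.h i) (L.σ ^ 2 * V i).toNNReal
      (L.K.mulVec W i) = gaussianPDFReal (L.μ * V i) (L.σ ^ 2 * V i).toNNReal
      ((L.K.mulVec W + L.μ • L.h) i) := by
    intro i
    simp only [gaussianPDFReal, Pi.add_apply, Pi.smul_apply, smul_eq_mul]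
    ring_nf
  simp only [jointPDF, fieldPDFCentered, fieldPDFNonCentered, h1, h2]
  ring

theorem integral_jointPDF_centered (V : Fin n → ℝ) :
    ∫ W, L.jointPDF y .centered W V = ∫ M, L.jointPDF y .nonCentered M V := by
  simp only [jointPDF_centered_eq]
  exact integral_abs_det_mul_comp_affine L.K_invertible _ fun M => L.jointPDF y .nonCentered M V

theorem posteriorPDF_centered : L.posteriorPDF y .centered = L.posteriorPDF y .nonCentered := by
  funext V
  simp only [posteriorPDF, integral_jointPDF_centered]

/-- The Jacobian `|det K|` cancels in the conditional density of `V` and appears once in that of the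
latent variable, where the change of variables absorbs it. Both samplers thus induce the same chain
on `V`. -/
theorem transitionPDF_centered : L.transitionPDF y .centered = L.transitionPDF y .nonCentered := by
  have hdet : L.K.det ≠ 0 := ((Matrix.isUnit_iff_isUnit_det L.K).1 L.K_invertible).ne_zero
  funext V V'
  have h1 : ∀ W, L.mixCondPDF y .centered W V' =
      L.mixCondPDF y .nonCentered (L.K.mulVec W + L.μ • L.h) V' := by
    intro W
    simp only [mixCondPDF, jointPDF_centered_eq]
    rw [integral_const_mul, mul_div_mul_left _ _ (abs_ne_zero.2 hdet)]
  have h2 : ∀ W, L.latentCondPDF y .centered V W =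
      |L.K.det| * L.latentCondPDF y .nonCentered V (L.K.mulVec W + L.μ • L.h) := by
    intro W
    simp only [latentCondPDF, integral_jointPDF_centered]
    rw [jointPDF_centered_eq, mul_div_assoc]
  simp only [transitionPDF, h1, h2, mul_left_comm _ |L.K.det|]
  exact integral_abs_det_mul_comp_affine L.K_invertible _ fun M =>
    L.mixCondPDF y .nonCentered M V' * L.latentCondPDF y .nonCentered V M

theorem isTraceClassChain_nonCentered
    (hL : (0 < L.a ∧ 0 < L.b) ∨ (0 < L.a ∧ L.b = 0 ∧ 1 / 2 < L.p)) :
    IsTraceClassChain (volume.restrict (orthant n)) (orthant n)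
      (L.posteriorPDF y .nonCentered) (L.transitionPDF y .nonCentered) := by
  have ha : 0 < L.a := hL.elim And.left And.left
  have hb : 0 < L.b ∨ (L.b = 0 ∧ 1 / 2 < L.p) := hL.imp And.right And.right
  have hv : (L.σε ^ 2).toNNReal ≠ 0 := by simpa using L.σε_pos.ne'
  have h := isTraceClassChain_latentJoint
    (L.X.mulVec L.β - (L.A * L.K⁻¹).mulVec (L.μ • L.h)) (L.A * L.K⁻¹) y (μ := L.μ) L.σ_pos ha hb hv
  rw [← jointPDF_nonCentered_eq] at h
  exact h

theorem isTraceClassChain (c : Parameterization)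
    (hL : (0 < L.a ∧ 0 < L.b) ∨ (0 < L.a ∧ L.b = 0 ∧ 1 / 2 < L.p)) :
    IsTraceClassChain (volume.restrict (orthant n)) (orthant n)
      (L.posteriorPDF y c) (L.transitionPDF y c) := by
  cases c with
  | centered =>
    rw [posteriorPDF_centered, transitionPDF_centered]
    exact L.isTraceClassChain_nonCentered y hL
  | nonCentered => exact L.isTraceClassChain_nonCentered y hL

end LLnGM

theorem theorem2p6 {m n d : ℕ} (L : LLnGM m n d) (y : Fin m → ℝ) (c : Parameterization)
    (hL : (0 < L.a ∧ 0 < L.b) ∨ (0 < L.a ∧ L.b = 0 ∧ 1 / 2 < L.p)) :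
    IsProbabilityMeasure (L.posterior y c) ∧
    (∀ V ∈ orthant n, ∫ V' in orthant n, L.transitionPDF y c V V' = 1) ∧
    ∃ Λ : Lp ℝ 2 (L.posterior y c) →L[ℝ] Lp ℝ 2 (L.posterior y c),
      L.IsMarkovOperator y c Λ ∧ IsTraceClass Λ := by
  exact L.isTraceClassChain y c hL
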